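/- **Conventions.** Formulas are terms of an algebraic language in the variables $x_0,x_1,\dots$. A *logic* is a finitary, substitution-invariant consequence relation $\vdash$ on formulas; $\vdash'$ *extends* $\vdash$ if $\Gamma\vdash\varphi$ implies $\Gamma\vdash'\varphi$. A rule $\Gamma\rhd\varphi$ ($\Gamma$ finite) is *derivable* in $\vdash$ if $\Gamma\vdash\varphi$, and *admissible* in $\vdash$ if every substitution $\sigma$ for which $\sigma(\gamma)$ is a theorem for all $\gamma\in\Gamma$ makes $\sigma(\varphi)$ a theorem. The *structural completion* of $\vdash$ is its unique extension with the same theorems in which every admissible rule is derivable. A set $R$ of rules is a *base for the admissible rules* of $\vdash$ if the structural completion is the least extension of $\vdash$ in which all the rules of $R$ are derivable. A quasivariety $\mathsf K$ is the *equivalent algebraic semantics* of $\vdash$ if there are a finite set $\tau(x)$ of equations and a finite set $\Delta(x,y)$ of formulas such that, for all $\Gamma\cup\{\varphi\}$, $\Gamma\vdash\varphi$ iff $\bigcup_{\gamma\in\Gamma}\tau(\gamma)\vDash_{\mathsf K}\tau(\varphi)$, and such that $x\approx y$ and $\bigcup_{\delta\in\Delta(x,y)}\tau(\delta)$ entail each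 other under $\vDash_{\mathsf K}$. A *product algebra* is a member of the variety generated by the standard product algebra $\langle[0,1];\min,\max,\cdot,\to,0,1\rangle$, where $a\to b=1$ if $a\le b$ and $a\to b=b/a$ otherwise. A *rational product algebra* is a product algebra with constants $\boldsymbol c_q$, $q\in[0,1]\cap\mathbb Q$, that validates $\boldsymbol c_p\cdot\boldsymbol c_q\approx\boldsymbol c_{pq}$, $\boldsymbol c_p\to\boldsymbol c_q\approx\boldsymbol c_{p\to q}$, $\boldsymbol c_0\approx0$ and $\boldsymbol c_1\approx1$. Let $\mathsf{RPA}$ be the class of these algebras, and let $\boldsymbol Q_\Pi\in\mathsf{RPA}$ be the one on $[0,1]\cap\mathbb Q$ with the operations above and with $\boldsymbol c_q$ interpreted as $q$; $\mathsf Q(\boldsymbol Q_\Pi)$ is the quasivariety it generates. *Rational product logic* $\mathrm{R\Pi}$ is the logic in which $\Gamma\vdash\varphi$ iff there is a finite $\Delta\subseteq\Gamma$ such that $\{\delta\approx1:\delta\in\Delta\}\vDash_{\mathsf{RPA}}\varphi\approx1$. We write $s\leftrightarrow t$ for $(s\to t)\wedge(t\to s)$, $x\le y$ for $x\wedge y\approx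 x$, and $x^n$ for the $n$-fold product. **Theorem.** Let $Q\subseteq(0,1)\cap\mathbb Q$ be nonempty (for example all of $(0,1)\cap\mathbb Q$, or a single point). 1. The structural completion of $\mathrm{R\Pi}$ is the unique extension of $\mathrm{R\Pi}$ whose equivalent algebraic semantics is $\mathsf Q(\boldsymbol Q_\Pi)$. 2. A base for the admissible rules of $\mathrm{R\Pi}$ is given by the rules $$\boldsymbol c_q\vee z\rhd z\qquad\text{and}\qquad(\boldsymbol c_p\leftrightarrow x^n)\vee z\rhd z,$$ for all $q\in Q$ and all $p\in[0,1]\cap\mathbb Q$, $n\ge1$ such that $\sqrt[n]{p}$ is irrational. 3. The universal theory of $\boldsymbol Q_\Pi$ is axiomatized relative to $\mathsf{RPA}$ by the sentences $\forall xy\,(x\le y\ \text{or}\ y\le x)$, $\boldsymbol c_q\not\approx1$ and $\forall x\,(\boldsymbol c_p\not\approx x^n)$, for all $q\in Q$ and all $p\in[0,1]\cap\mathbb Q$, $n\ge1$ such that $\sqrt[n]{p}$ is irrational. That is, a rational product algebra satisfies all universal sentences true in $\boldsymbol Q_\Pi$ if and only if it satisfies these sentences. -/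

import Mathlib

universe u v

namespace RPL

/-! ### Propositional logics over an algebraic language

Formulas of a language `L` are the terms of `L` with variables `xₙ`, `n ∈ ℕ`. -/

section General

variable {L : FirstOrder.Language.{0, 0}}

/-- A finitary, substitution-invariant consequence relation on the formulas of `L`. -/
@[ext]
structure PropLogic (L : FirstOrder.Language.{0, 0}) where
  /-- `Ent Γ φ` is `Γ ⊢ φ`. -/
  Ent : Set (L.Term ℕ) → L.Term ℕ → Prop
  refl : ∀ Γ φ, φ ∈ Γ → Ent Γ φ
  cut : ∀ Γ Δ φ, (∀ ψ ∈ Δ, Ent Γ ψ) → Ent Δ φ → Ent Γ φ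
  substInvariant : ∀ (σ : ℕ → L.Term ℕ) Γ φ, Ent Γ φ →
    Ent ((fun γ => γ.subst σ) '' Γ) (φ.subst σ)
  finitary : ∀ Γ φ, Ent Γ φ → ∃ Δ : Set (L.Term ℕ), Δ.Finite ∧ Δ ⊆ Γ ∧ Ent Δ φ

/-- `S'` is an extension of `S` (in the same language). -/
def IsExtension (S S' : PropLogic L) : Prop :=
  ∀ Γ φ, S.Ent Γ φ → S'.Ent Γ φ

/-- A rule `Γ ▷ φ`, with `Γ` a finite set of formulas. -/
structure Rule (L : FirstOrder.Language.{0, 0}) where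
  prem : Finset (L.Term ℕ)
  concl : L.Term ℕ

/-- `Γ ▷ φ` is derivable in `S` if `Γ ⊢ φ`. -/
def Rule.Derivable (S : PropLogic L) (r : Rule L) : Prop :=
  S.Ent (r.prem : Set (L.Term ℕ)) r.concl

/-- `Γ ▷ φ` is admissible in `S` if each substitution that turns all of `Γ` into theorems turns
`φ` into a theorem. -/
def Rule.Admissible (S : PropLogic L) (r : Rule L) : Prop :=
  ∀ σ : ℕ → L.Term ℕ, (∀ γ ∈ r.prem, S.Ent ∅ (γ.subst σ)) → S.Ent ∅ (r.concl.subst σ)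

/-- Every admissible rule is derivable. -/
def IsStructurallyComplete (S : PropLogic L) : Prop :=
  ∀ r : Rule L, r.Admissible S → r.Derivable S

/-- `S'` is a structurally complete extension of `S` with the same theorems. -/
def IsStructuralCompletion (S S' : PropLogic L) : Prop :=
  IsExtension S S' ∧ IsStructurallyComplete S' ∧ ∀ φ, S'.Ent ∅ φ ↔ S.Ent ∅ φ

/-- `S'` is the logic obtained by adding the rules in `R` to `S`: the least extension of `S` in
which all the rules in `R` are derivable. -/
def IsAxiomatizedRelativeTo (S : PropLogic L) (R : Set (Rule L)) (S' : PropLogic L) : Prop :=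
  (IsExtension S S' ∧ ∀ r ∈ R, r.Derivable S') ∧
    ∀ S'' : PropLogic L, IsExtension S S'' → (∀ r ∈ R, r.Derivable S'') → IsExtension S' S''

/-- `R` is a base for the admissible rules of `S`: adding `R` to `S` axiomatizes the structural
completion of `S`. -/
def IsBaseForAdmissibleRules (S : PropLogic L) (R : Set (Rule L)) : Prop :=
  ∃ S' : PropLogic L, IsStructuralCompletion S S' ∧ IsAxiomatizedRelativeTo S R S'

/-! ### Equations, quasiequations, (quasi)varieties -/

/-- An equation `s ≈ t` in the variables `α`. -/
abbrev Eqn (L : FirstOrder.Language.{0, 0}) (α : Type) := L.Term α × L.Term α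

/-- The equation `e` is true in `A` under the assignment `w`. -/
def Eqn.Holds {α : Type} {A : Type u} [L.Structure A] (w : α → A) (e : Eqn L α) : Prop :=
  e.1.realize w = e.2.realize w

/-- The universal closure of the equation `e` is true in `A`. -/
def Eqn.Valid (A : Type u) [L.Structure A] (e : Eqn L ℕ) : Prop :=
  ∀ w : ℕ → A, Eqn.Holds w e

/-- A quasiequation; the finite set of premises may be empty. -/
structure Quasieqn (L : FirstOrder.Language.{0, 0}) where
  prem : Finset (Eqn L ℕ)
  concl : Eqn L ℕ

/-- The universal closure of the quasiequation `q` is true in `A`. -/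
def Quasieqn.Valid (A : Type u) [L.Structure A] (q : Quasieqn L) : Prop :=
  ∀ w : ℕ → A, (∀ e ∈ q.prem, Eqn.Holds w e) → Eqn.Holds w q.concl

/-- A class of algebras of the language `L`. -/
abbrev AlgClass (L : FirstOrder.Language.{0, 0}) := (A : Type u) → [L.Structure A] → Prop

/-- A class axiomatized by quasiequations. -/
def IsQuasivariety (K : AlgClass.{u} L) : Prop :=
  ∃ Θ : Set (Quasieqn L), ∀ (A : Type u) [L.Structure A], K A ↔ ∀ q ∈ Θ, q.Valid A

/-- The variety generated by the algebra `B`: the models of all equations valid in `B`. -/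
def varietyGen (B : Type v) [L.Structure B] : AlgClass.{u} L :=
  fun A _ => ∀ e : Eqn L ℕ, Eqn.Valid B e → Eqn.Valid A e

/-- The quasivariety generated by the algebra `B`: the models of all quasiequations valid
in `B`. -/
def quasivarietyGen (B : Type v) [L.Structure B] : AlgClass.{u} L :=
  fun A _ => ∀ q : Quasieqn L, q.Valid B → q.Valid A

/-- `quasivarietyGen B` is the least quasivariety containing `B`. -/
theorem quasivarietyGen_least (B : Type u) [L.Structure B] :
    IsQuasivariety (quasivarietyGen.{u} (L := L) B) ∧ quasivarietyGen.{u} (L := L) B B ∧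
      ∀ K : AlgClass.{u} L, IsQuasivariety K → K B →
        ∀ (A : Type u) [L.Structure A], quasivarietyGen.{u} (L := L) B A → K A :=
  ⟨⟨{q | q.Valid B}, fun _ _ => Iff.rfl⟩, fun _ h => h, fun _ ⟨_, hΘ⟩ hB A _ hA =>
    (hΘ A).2 fun q hq => hA q ((hΘ B).1 hB q hq)⟩

/-- Equational consequence relative to the class `K`. -/
def EqConseq (K : AlgClass.{u} L) (Θ : Set (Eqn L ℕ)) (e : Eqn L ℕ) : Prop :=
  ∀ (A : Type u) [L.Structure A], K A → ∀ w : ℕ → A,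
    (∀ e' ∈ Θ, Eqn.Holds w e') → Eqn.Holds w e

/-- `τ(φ)`, for a set `τ` of equations in one variable and a formula `φ`. -/
def instEqns (τ : Set (Eqn L Unit)) (φ : L.Term ℕ) : Set (Eqn L ℕ) :=
  (fun e => (e.1.subst fun _ => φ, e.2.subst fun _ => φ)) '' τ

/-- `Δ(φ, ψ)`, for a set `Δ` of formulas in two variables and formulas `φ`, `ψ`. -/
def instFmls (Δ : Set (L.Term (Fin 2))) (φ ψ : L.Term ℕ) : Set (L.Term ℕ) :=
  (fun δ => δ.subst ![φ, ψ]) '' Δ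

/-- The logic `S` is algebraized by the quasivariety `K`, i.e. `K` is the equivalent algebraic
semantics of `S`. -/
def IsAlgebraizedBy (S : PropLogic L) (K : AlgClass.{u} L) : Prop :=
  IsQuasivariety K ∧
    ∃ (τ : Set (Eqn L Unit)) (Δ : Set (L.Term (Fin 2))), τ.Finite ∧ Δ.Finite ∧
      (∀ (Γ : Set (L.Term ℕ)) (φ : L.Term ℕ),
        S.Ent Γ φ ↔ ∀ e ∈ instEqns τ φ, EqConseq K (⋃ γ ∈ Γ, instEqns τ γ) e) ∧
      (∀ e ∈ ⋃ δ ∈ instFmls Δ (.var 0) (.var 1), instEqns τ δ,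
        EqConseq K {(.var 0, .var 1)} e) ∧
      EqConseq K (⋃ δ ∈ instFmls Δ (.var 0) (.var 1), instEqns τ δ) (.var 0, .var 1)

end General

/-! ### The language of BL-algebras with constants -/

/-- The symbols `0, 1, ∧, ∨, ·, →` together with constants `c_q`, for `q` in an index type. -/
inductive BLFunc (C : Type) : ℕ → Type
  | zero : BLFunc C 0
  | one : BLFunc C 0
  | const (c : C) : BLFunc C 0
  | meet : BLFunc C 2
  | join : BLFunc C 2
  | mul : BLFunc C 2
  | imp : BLFunc C 2

/-- The language of BL-algebras expanded with constants indexed by `C`. -/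
def blLang (C : Type) : FirstOrder.Language.{0, 0} := ⟨BLFunc C, fun _ => Empty⟩

/-- The rationals in `[0, 1]`. -/
abbrev RatUnit : Type := Set.Icc (0 : ℚ) 1

/-- The language of BL-algebras. -/
abbrev BL : FirstOrder.Language.{0, 0} := blLang Empty

/-- The language of BL-algebras with a constant `c_q` for each `q ∈ [0, 1] ∩ ℚ`. -/
abbrev RBL : FirstOrder.Language.{0, 0} := blLang RatUnit

/-- The inclusion of the language of BL-algebras. -/
def blIncl : FirstOrder.Language.LHom BL RBL where
  onFunction := fun _ f => match f with
    | .zero => BLFunc.zero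
    | .one => BLFunc.one
    | .const c => c.elim
    | .meet => BLFunc.meet
    | .join => BLFunc.join
    | .mul => BLFunc.mul
    | .imp => BLFunc.imp
  onRelation := fun _ r => Empty.elim r

section Terms

variable {C : Type} {α : Type}

def tZero : (blLang C).Term α := .func (BLFunc.zero : (blLang C).Functions 0) ![]
def tOne : (blLang C).Term α := .func (BLFunc.one : (blLang C).Functions 0) ![]
def tConst (c : C) : (blLang C).Term α := .func (BLFunc.const c : (blLang C).Functions 0) ![]
def tMeet (s t : (blLang C).Term α) : (blLang C).Term α :=
  .func (BLFunc.meet : (blLang C).Functions 2) ![s, t]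
def tJoin (s t : (blLang C).Term α) : (blLang C).Term α :=
  .func (BLFunc.join : (blLang C).Functions 2) ![s, t]
def tMul (s t : (blLang C).Term α) : (blLang C).Term α :=
  .func (BLFunc.mul : (blLang C).Functions 2) ![s, t]
def tImp (s t : (blLang C).Term α) : (blLang C).Term α :=
  .func (BLFunc.imp : (blLang C).Functions 2) ![s, t]

/-- `s ↔ t`. -/
def tIff (s t : (blLang C).Term α) : (blLang C).Term α := tMeet (tImp s t) (tImp t s)

/-- `tⁿ`, the `n`-fold product. -/
def tPow (t : (blLang C).Term α) : ℕ → (blLang C).Term α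
  | 0 => tOne
  | n + 1 => tMul (tPow t n) t

end Terms

/-! ### The product algebras on the unit intervals of `ℝ` and `ℚ` -/

section Product

variable {F : Type} [Field F] [LinearOrder F] [IsStrictOrderedRing F]

/-- The residuum of the product t-norm: `1` if `a ≤ b`, and `b / a` otherwise. -/
def prodImp (a b : Set.Icc (0 : F) 1) : Set.Icc (0 : F) 1 :=
  ⟨if a.1 ≤ b.1 then 1 else b.1 / a.1, by
    split_ifs with h
    · exact ⟨zero_le_one, le_rfl⟩
    · push Not at h
      exact ⟨div_nonneg b.2.1 a.2.1, div_le_one_of_le₀ h.le a.2.1⟩⟩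

/-- `prodImp a c` is the largest `b` with `b * a ≤ c`. -/
theorem prodImp_isGreatest (a c : Set.Icc (0 : F) 1) :
    IsGreatest {b : Set.Icc (0 : F) 1 | b * a ≤ c} (prodImp a c) := by
  obtain ⟨a, ha0, ha1⟩ := a
  obtain ⟨c, hc0, hc1⟩ := c
  constructor
  · show (if a ≤ c then (1 : F) else c / a) * a ≤ c
    split_ifs with h
    · simpa using h
    · push Not at h
      rw [div_mul_cancel₀ _ (hc0.trans_lt h).ne']
  · rintro ⟨b, hb0, hb1⟩ hb
    change b * a ≤ c at hb
    show b ≤ if a ≤ c then (1 : F) else c / a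
    split_ifs with h
    · exact hb1
    · push Not at h
      rwa [le_div_iff₀ (hc0.trans_lt h)]

/-- The algebra on the unit interval of `F` given by the order, the product and its residuum, with
prescribed values of the constants. -/
@[reducible]
def prodStructure {C : Type} (k : C → Set.Icc (0 : F) 1) :
    (blLang C).Structure (Set.Icc (0 : F) 1) where
  funMap := fun f => match f with
    | .zero => fun _ => 0
    | .one => fun _ => 1
    | .const c => fun _ => k c
    | .meet => fun a => min (a 0) (a 1)
    | .join => fun a => max (a 0) (a 1)
    | .mul => fun a => a 0 * a 1
    | .imp => fun a => prodImp (a 0) (a 1)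
  RelMap := fun r => Empty.elim r

end Product

/-- The standard product algebra on `[0, 1]`. -/
noncomputable instance standardProduct : BL.Structure (Set.Icc (0 : ℝ) 1) :=
  prodStructure Empty.elim

/-- The rational product algebra on `[0, 1] ∩ ℚ`, in which `c_q` is interpreted as `q`. -/
instance rationalProduct : RBL.Structure RatUnit :=
  prodStructure id

/-! ### Rational product algebras and rational product logic -/

/-- Product algebras: the variety generated by the standard product algebra. -/
def IsProductAlgebra : AlgClass.{u} BL :=
  varietyGen (Set.Icc (0 : ℝ) 1)

/-- Rational product algebras: the BL-reduct is a product algebra, and the bookkeeping axioms are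
valid. -/
def IsRationalProductAlgebra : AlgClass.{u} RBL := fun A _ =>
  (@IsProductAlgebra A (blIncl.reduct A)) ∧
    (∀ p q : RatUnit, Eqn.Valid A (tMul (tConst p) (tConst q), tConst (p * q))) ∧
    (∀ p q : RatUnit, Eqn.Valid A (tImp (tConst p) (tConst q), tConst (prodImp p q))) ∧
    Eqn.Valid A (tConst (0 : RatUnit), tZero) ∧
    Eqn.Valid A (tConst (1 : RatUnit), tOne)

/-- Rational product logic: `Γ ⊢ φ` iff for some finite `Δ ⊆ Γ`, the equation `φ ≈ 1` follows from
the equations `δ ≈ 1`, `δ ∈ Δ`, relative to the class of rational product algebras. -/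
def rationalProductLogic : PropLogic RBL where
  Ent Γ φ := ∃ Δ : Set (RBL.Term ℕ), Δ.Finite ∧ Δ ⊆ Γ ∧
    EqConseq IsRationalProductAlgebra.{u} ((fun δ => (δ, tOne)) '' Δ) (φ, tOne)
  refl Γ φ h := ⟨{φ}, Set.finite_singleton φ, by simpa using h,
    fun A _ _ w hw => hw _ ⟨φ, rfl, rfl⟩⟩
  cut := by
    rintro Γ Δ φ h ⟨Δ', hfin, hsub, hΔ'⟩
    choose! f hf1 hf2 hf3 using h
    refine ⟨⋃ ψ ∈ Δ', f ψ, hfin.biUnion fun ψ hψ => hf1 ψ (hsub hψ),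
      Set.iUnion₂_subset fun ψ hψ => hf2 ψ (hsub hψ), fun A _ hA w hw => hΔ' A hA w ?_⟩
    rintro _ ⟨ψ, hψ, rfl⟩
    refine hf3 ψ (hsub hψ) A hA w ?_
    rintro _ ⟨χ, hχ, rfl⟩
    exact hw _ ⟨χ, Set.mem_biUnion hψ hχ, rfl⟩
  substInvariant := by
    rintro σ Γ φ ⟨Δ, hfin, hsub, hΔ⟩
    have key : ∀ (A : Type u) [RBL.Structure A] (w : ℕ → A) (ψ : RBL.Term ℕ),
        Eqn.Holds w (ψ.subst σ, tOne) ↔ Eqn.Holds (fun n => (σ n).realize w) (ψ, tOne) := by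
      intro A _ w ψ
      have h1 : (tOne : RBL.Term ℕ).subst σ = tOne := by
        simp only [tOne, FirstOrder.Language.Term.subst]
        congr 1
        exact Subsingleton.elim _ _
      unfold Eqn.Holds
      conv_lhs => rw [← h1]
      simp only [FirstOrder.Language.Term.realize_subst]
    refine ⟨_, hfin.image _, Set.image_mono hsub, fun A _ hA w hw => ?_⟩
    rw [key]
    refine hΔ A hA _ ?_
    rintro _ ⟨δ, hδ, rfl⟩
    rw [← key]
    exact hw _ ⟨_, ⟨δ, hδ, rfl⟩, rfl⟩
  finitary := by
    rintro Γ φ ⟨Δ, hfin, hsub, hΔ⟩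
    exact ⟨Δ, hfin, hsub, Δ, hfin, subset_rfl, hΔ⟩

/-! ### The rules and the sentences of the theorem -/

/-- The rule `c_q ∨ z ▷ z`. -/
def constRule (q : RatUnit) : Rule RBL where
  prem := {tJoin (tConst q) (.var 1)}
  concl := .var 1

/-- The rule `(c_p ↔ xⁿ) ∨ z ▷ z`. -/
def rootRule (p : RatUnit) (n : ℕ) : Rule RBL where
  prem := {tJoin (tIff (tConst p) (tPow (.var 0) n)) (.var 1)}
  concl := .var 1

/-- `n ≥ 1` and the `n`-th root of `p` is irrational. -/
def IrrationalRoot (p : RatUnit) (n : ℕ) : Prop :=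
  1 ≤ n ∧ Irrational ((((p : ℚ) : ℝ)) ^ ((1 : ℝ) / (n : ℝ)))

/-- The rules `c_q ∨ z ▷ z` for `q ∈ Q`, and `(c_p ↔ xⁿ) ∨ z ▷ z` whenever the `n`-th root of `p` is
irrational. -/
def baseRules (Q : Set RatUnit) : Set (Rule RBL) :=
  {r | ∃ q ∈ Q, r = constRule q} ∪ {r | ∃ p n, IrrationalRoot p n ∧ r = rootRule p n}

/-- `A` satisfies the universal theory of `B`: all universal first-order sentences (universally
quantified open formulas) that are true in `B`. -/
def SatisfiesUniversalTheory (B : Type v) [RBL.Structure B] : AlgClass.{u} RBL := fun A _ =>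
  ∀ φ : RBL.Sentence, φ.IsUniversal → φ.Realize B → φ.Realize A

/-- The sentences `∀ x y (x ≤ y or y ≤ x)`, `c_q ≠ 1` for `q ∈ Q`, and `∀ x (c_p ≠ xⁿ)` whenever the
`n`-th root of `p` is irrational; here `x ≤ y` stands for `x ∧ y ≈ x`. -/
def SatisfiesChainAxioms (Q : Set RatUnit) : AlgClass.{u} RBL := fun A _ =>
  (∀ w : ℕ → A, Eqn.Holds w (L := RBL) (tMeet (.var 0) (.var 1), .var 0) ∨
    Eqn.Holds w (L := RBL) (tMeet (.var 1) (.var 0), .var 1)) ∧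
  (∀ q ∈ Q, ∀ w : ℕ → A, ¬ Eqn.Holds w (L := RBL) (tConst q, tOne)) ∧
  ∀ p n, IrrationalRoot p n →
    ∀ w : ℕ → A, ¬ Eqn.Holds w (L := RBL) (tConst p, tPow (.var 0) n)

end RPL

/-! Everything is reduced to one logic, `ratLogic`, the finitary consequence relation of preserving
the value 1 in the algebra on [0,1] ∩ ℚ. It is structurally complete because each element of that
algebra is named by a constant: an assignment refuting a rule is the same thing as a substitution by
constants, which witnesses that the rule is not admissible. Taking quotients by provable equivalence
shows that its equivalent algebraic semantics is the quasivariety generated by the algebra. What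
remains is to transfer failures from arbitrary rational product algebras to the rational one.

Formulas are first pushed into chains: a maximal theory avoiding a suitable set of formulas is
linear, and its Lindenbaum algebra is a chain (`IsTheory.exists_prime`). In a nontrivial chain the
nonzero elements form a cancellative ordered monoid, so the chain is the part below 1 of an ordered
abelian group with zero (`exists_coneEmbedding`), and the constants extend to a homomorphism κ from
the nonnegative rationals.

Values of terms are then monomials with rational coefficients, and the value of a term is settled by
finitely many comparisons of monomials. Strict inequalities always transfer: κ(x) < 1 implies x < 1,
and Fourier–Motzkin elimination turns a solution in an ordered group into a positive rational one,
real roots being approximated by rationals (`exists_rat_monomial_lt_one`). A tie in the chain may be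
broken in the rationals, but a failure φ < 1 is itself strict and survives. Hence `ratLogic` has the
same theorems as rational product logic, even though the constants of a chain may collapse.

Transferring equalities as well requires that ties be genuine. If no constant below 1 equals 1 and
no constant acquires an irrational root, then κ is injective on the positive rationals and its image
is a pure subgroup. A finitely generated subgroup of the quotient by it is torsion-free, hence free,
so the generators can be chosen independent modulo constants; two monomials with equal value then
coincide (`exists_faithful_representation`). Thus finite parts of such chains embed in the rational
algebra, which gives the universal theory. The rules of the base say exactly that the maximal
theories can be chosen to avoid the forbidden constants and roots, which gives the base. -/

namespace RPL

open FirstOrder FirstOrder.Language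

/-! ### Terms: substitution, translation and realization -/

section TermLemmas

variable {C α β : Type}

@[simp] theorem subst_var {L : FirstOrder.Language.{0, 0}} (x : α) (σ : α → L.Term β) :
    (Term.var x : L.Term α).subst σ = σ x := rfl

@[simp] theorem subst_tZero (σ : α → (blLang C).Term β) :
    (tZero : (blLang C).Term α).subst σ = tZero := by
  simp only [tZero, Term.subst]; congr 1; exact Subsingleton.elim _ _

@[simp] theorem subst_tOne (σ : α → (blLang C).Term β) :
    (tOne : (blLang C).Term α).subst σ = tOne := by
  simp only [tOne, Term.subst]; congr 1; exact Subsingleton.elim _ _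

@[simp] theorem subst_tConst (σ : α → (blLang C).Term β) (c : C) :
    (tConst c : (blLang C).Term α).subst σ = tConst c := by
  simp only [tConst, Term.subst]; congr 1; exact Subsingleton.elim _ _

@[simp] theorem subst_tMeet (σ : α → (blLang C).Term β) (s t : (blLang C).Term α) :
    (tMeet s t).subst σ = tMeet (s.subst σ) (t.subst σ) := by
  simp only [tMeet, Term.subst]; congr 1; funext i; fin_cases i <;> rfl

@[simp] theorem subst_tJoin (σ : α → (blLang C).Term β) (s t : (blLang C).Term α) :
    (tJoin s t).subst σ = tJoin (s.subst σ) (t.subst σ) := by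
  simp only [tJoin, Term.subst]; congr 1; funext i; fin_cases i <;> rfl

@[simp] theorem subst_tMul (σ : α → (blLang C).Term β) (s t : (blLang C).Term α) :
    (tMul s t).subst σ = tMul (s.subst σ) (t.subst σ) := by
  simp only [tMul, Term.subst]; congr 1; funext i; fin_cases i <;> rfl

@[simp] theorem subst_tImp (σ : α → (blLang C).Term β) (s t : (blLang C).Term α) :
    (tImp s t).subst σ = tImp (s.subst σ) (t.subst σ) := by
  simp only [tImp, Term.subst]; congr 1; funext i; fin_cases i <;> rfl

@[simp] theorem subst_tIff (σ : α → (blLang C).Term β) (s t : (blLang C).Term α) :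
    (tIff s t).subst σ = tIff (s.subst σ) (t.subst σ) := by simp [tIff]

@[simp] theorem subst_tPow (σ : α → (blLang C).Term β) (s : (blLang C).Term α) (n : ℕ) :
    (tPow s n).subst σ = tPow (s.subst σ) n := by
  induction n with
  | zero => simp [tPow]
  | succ n ih => simp [tPow, ih]

@[simp] theorem onTerm_var (x : α) : blIncl.onTerm (Term.var x) = Term.var x := rfl

@[simp] theorem onTerm_tZero : blIncl.onTerm (tZero : BL.Term α) = tZero := by
  simp only [tZero, LHom.onTerm]
  exact congrArg _ (Subsingleton.elim _ _)

@[simp] theorem onTerm_tOne : blIncl.onTerm (tOne : BL.Term α) = tOne := by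
  simp only [tOne, LHom.onTerm]
  exact congrArg _ (Subsingleton.elim _ _)

@[simp] theorem onTerm_tMeet (s t : BL.Term α) :
    blIncl.onTerm (tMeet s t) = tMeet (blIncl.onTerm s) (blIncl.onTerm t) := by
  simp only [tMeet, LHom.onTerm]
  refine congrArg _ ?_; funext i; fin_cases i <;> rfl

@[simp] theorem onTerm_tJoin (s t : BL.Term α) :
    blIncl.onTerm (tJoin s t) = tJoin (blIncl.onTerm s) (blIncl.onTerm t) := by
  simp only [tJoin, LHom.onTerm]
  refine congrArg _ ?_; funext i; fin_cases i <;> rfl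

@[simp] theorem onTerm_tMul (s t : BL.Term α) :
    blIncl.onTerm (tMul s t) = tMul (blIncl.onTerm s) (blIncl.onTerm t) := by
  simp only [tMul, LHom.onTerm]
  refine congrArg _ ?_; funext i; fin_cases i <;> rfl

@[simp] theorem onTerm_tImp (s t : BL.Term α) :
    blIncl.onTerm (tImp s t) = tImp (blIncl.onTerm s) (blIncl.onTerm t) := by
  simp only [tImp, LHom.onTerm]
  refine congrArg _ ?_; funext i; fin_cases i <;> rfl

@[simp] theorem onTerm_tIff (s t : BL.Term α) :
    blIncl.onTerm (tIff s t) = tIff (blIncl.onTerm s) (blIncl.onTerm t) := by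
  simp [tIff]

@[simp] theorem onTerm_tPow (s : BL.Term α) (n : ℕ) :
    blIncl.onTerm (tPow s n) = tPow (blIncl.onTerm s) n := by
  induction n with
  | zero => simp [tPow]
  | succ n ih => simp [tPow, ih]

end TermLemmas

/-! ### The operations of an algebra with constants -/

section Ops

variable {A : Type u} [RBL.Structure A]

def opZero (A : Type u) [RBL.Structure A] : A :=
  Structure.funMap (L := RBL) (BLFunc.zero : RBL.Functions 0) ![]
def opOne (A : Type u) [RBL.Structure A] : A :=
  Structure.funMap (L := RBL) (BLFunc.one : RBL.Functions 0) ![]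
def opConst (A : Type u) [RBL.Structure A] (c : RatUnit) : A :=
  Structure.funMap (L := RBL) (BLFunc.const c : RBL.Functions 0) ![]
def opMeet (a b : A) : A := Structure.funMap (L := RBL) (BLFunc.meet : RBL.Functions 2) ![a, b]
def opJoin (a b : A) : A := Structure.funMap (L := RBL) (BLFunc.join : RBL.Functions 2) ![a, b]
def opMul (a b : A) : A := Structure.funMap (L := RBL) (BLFunc.mul : RBL.Functions 2) ![a, b]
def opImp (a b : A) : A := Structure.funMap (L := RBL) (BLFunc.imp : RBL.Functions 2) ![a, b]

def opPow (a : A) : ℕ → A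
  | 0 => opOne A
  | n + 1 => opMul (opPow a n) a

variable {α : Type} (w : α → A)

@[simp] theorem realize_tZero : (tZero : RBL.Term α).realize w = opZero A := by
  refine congrArg (Structure.funMap _) ?_; exact Subsingleton.elim _ _
@[simp] theorem realize_tOne : (tOne : RBL.Term α).realize w = opOne A := by
  refine congrArg (Structure.funMap _) ?_; exact Subsingleton.elim _ _
@[simp] theorem realize_tConst (c : RatUnit) :
    (tConst c : RBL.Term α).realize w = opConst A c := by
  refine congrArg (Structure.funMap _) ?_; exact Subsingleton.elim _ _
@[simp] theorem realize_tMeet (s t : RBL.Term α) :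
    (tMeet s t).realize w = opMeet (s.realize w) (t.realize w) := by
  refine congrArg (Structure.funMap _) ?_; funext i; fin_cases i <;> rfl
@[simp] theorem realize_tJoin (s t : RBL.Term α) :
    (tJoin s t).realize w = opJoin (s.realize w) (t.realize w) := by
  refine congrArg (Structure.funMap _) ?_; funext i; fin_cases i <;> rfl
@[simp] theorem realize_tMul (s t : RBL.Term α) :
    (tMul s t).realize w = opMul (s.realize w) (t.realize w) := by
  refine congrArg (Structure.funMap _) ?_; funext i; fin_cases i <;> rfl
@[simp] theorem realize_tImp (s t : RBL.Term α) :
    (tImp s t).realize w = opImp (s.realize w) (t.realize w) := by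
  refine congrArg (Structure.funMap _) ?_; funext i; fin_cases i <;> rfl
@[simp] theorem realize_tIff (s t : RBL.Term α) : (tIff s t).realize w =
    opMeet (opImp (s.realize w) (t.realize w)) (opImp (t.realize w) (s.realize w)) := by
  simp [tIff]
@[simp] theorem realize_tPow (s : RBL.Term α) (n : ℕ) :
    (tPow s n).realize w = opPow (s.realize w) n := by
  induction n with
  | zero => simp [tPow, opPow]
  | succ n ih => simp [tPow, opPow, ih]

/-- The terms of the language with constants are generated by its operations. -/
theorem term_induction {p : RBL.Term α → Prop} (var : ∀ x, p (.var x)) (zero : p tZero)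
    (one : p tOne) (const : ∀ c, p (tConst c)) (meet : ∀ s t, p s → p t → p (tMeet s t))
    (join : ∀ s t, p s → p t → p (tJoin s t)) (mul : ∀ s t, p s → p t → p (tMul s t))
    (imp : ∀ s t, p s → p t → p (tImp s t)) (t : RBL.Term α) : p t := by
  induction t with
  | var x => exact var x
  | @func n f ts ih =>
    have h0 : ∀ ts : Fin 0 → RBL.Term α, ts = ![] := fun _ => Subsingleton.elim _ _
    have h2 : ∀ ts : Fin 2 → RBL.Term α, ts = ![ts 0, ts 1] := fun ts => by
      funext i; fin_cases i <;> rfl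
    change BLFunc RatUnit n at f
    cases f with
    | zero => rw [h0 ts]; exact zero
    | one => rw [h0 ts]; exact one
    | const c => rw [h0 ts]; exact const c
    | meet => rw [h2 ts]; exact meet _ _ (ih 0) (ih 1)
    | join => rw [h2 ts]; exact join _ _ (ih 0) (ih 1)
    | mul => rw [h2 ts]; exact mul _ _ (ih 0) (ih 1)
    | imp => rw [h2 ts]; exact imp _ _ (ih 0) (ih 1)

end Ops

/-! ### The standard product algebra -/

section Standard

variable {α : Type} (w : α → Set.Icc (0 : ℝ) 1)

@[simp] theorem realize_std_zero : (tZero : BL.Term α).realize w = 0 := rfl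
@[simp] theorem realize_std_one : (tOne : BL.Term α).realize w = 1 := rfl
@[simp] theorem realize_std_meet (s t : BL.Term α) :
    (tMeet s t).realize w = min (s.realize w) (t.realize w) := rfl
@[simp] theorem realize_std_join (s t : BL.Term α) :
    (tJoin s t).realize w = max (s.realize w) (t.realize w) := rfl
@[simp] theorem realize_std_mul (s t : BL.Term α) :
    (tMul s t).realize w = s.realize w * t.realize w := rfl
@[simp] theorem realize_std_imp (s t : BL.Term α) :
    (tImp s t).realize w = prodImp (s.realize w) (t.realize w) := rfl
@[simp] theorem realize_std_pow (s : BL.Term α) (n : ℕ) :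
    (tPow s n).realize w = s.realize w ^ n := by
  induction n with
  | zero => rfl
  | succ n ih => simp [tPow, ih, pow_succ]

variable {F : Type} [Field F] [LinearOrder F] [IsStrictOrderedRing F]

theorem le_prodImp {x y z : Set.Icc (0 : F) 1} : x ≤ prodImp y z ↔ x * y ≤ z := by
  refine ⟨fun h => ?_, fun h => (prodImp_isGreatest y z).2 h⟩
  have h1 : prodImp y z * y ≤ z := (prodImp_isGreatest y z).1
  refine le_trans ?_ h1
  have h2 : x.1 * y.1 ≤ (prodImp y z).1 * y.1 :=
    mul_le_mul_of_nonneg_right (show x.1 ≤ (prodImp y z).1 from h) y.2.1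
  exact h2

theorem prodImp_eq_one {x y : Set.Icc (0 : F) 1} : prodImp x y = 1 ↔ x ≤ y := by
  have h : (1 : Set.Icc (0 : F) 1) ≤ prodImp x y ↔ x ≤ y := by rw [le_prodImp, one_mul]
  rw [← h]
  exact ⟨fun h => h.ge, fun h => le_antisymm (prodImp x y).2.2 h⟩

variable {a b c d : Set.Icc (0 : ℝ) 1}

theorem prodImp_mul_le (x y : Set.Icc (0 : ℝ) 1) : prodImp x y * x ≤ y :=
  le_prodImp.1 le_rfl

theorem icc_mul_le_mul (h : a ≤ b) (h' : c ≤ d) : a * c ≤ b * d := by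
  have : a.1 * c.1 ≤ b.1 * d.1 := mul_le_mul h h' c.2.1 b.2.1
  exact this

theorem icc_mul_le_left (a b : Set.Icc (0 : ℝ) 1) : a * b ≤ a := by
  have := icc_mul_le_mul (le_refl a) (show b ≤ 1 from b.2.2)
  rwa [mul_one] at this

theorem icc_mul_le_right (a b : Set.Icc (0 : ℝ) 1) : a * b ≤ b := by
  rw [mul_comm]; exact icc_mul_le_left b a

end Standard

/-- The assignment of the first four variables. -/
def asg {X : Type u} (a b c d : X) : ℕ → X
  | 0 => a
  | 1 => b
  | 2 => c
  | _ + 3 => d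

section Asg
variable {X : Type u} (a b c d : X)
@[simp] theorem asg_zero : asg a b c d 0 = a := rfl
@[simp] theorem asg_one : asg a b c d 1 = b := rfl
@[simp] theorem asg_two : asg a b c d 2 = c := rfl
@[simp] theorem asg_three : asg a b c d 3 = d := rfl
end Asg

/-- Equations of the standard product algebra hold in rational product algebras. -/
theorem IsRationalProductAlgebra.eq_of_standard {A : Type u} [RBL.Structure A]
    (hA : IsRationalProductAlgebra A) {s t : BL.Term ℕ}
    (h : ∀ w : ℕ → Set.Icc (0 : ℝ) 1, s.realize w = t.realize w) (w : ℕ → A) :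
    (blIncl.onTerm s).realize w = (blIncl.onTerm t).realize w := by
  let _ : BL.Structure A := blIncl.reduct A
  rw [LHom.realize_onTerm, LHom.realize_onTerm]
  exact hA.1 (s, t) h w

/-! ### Tautologies of the standard product algebra -/

/-- The term `t` has value `1` in the standard product algebra. -/
def IsTaut (t : BL.Term ℕ) : Prop := ∀ w : ℕ → Set.Icc (0 : ℝ) 1, t.realize w = 1

local notation "x₀" => (Term.var 0 : BL.Term ℕ)
local notation "x₁" => (Term.var 1 : BL.Term ℕ)
local notation "x₂" => (Term.var 2 : BL.Term ℕ)
local notation "x₃" => (Term.var 3 : BL.Term ℕ)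

theorem isTaut_imp {s t : BL.Term ℕ} :
    IsTaut (tImp s t) ↔ ∀ w : ℕ → Set.Icc (0 : ℝ) 1, s.realize w ≤ t.realize w := by
  simp [IsTaut, prodImp_eq_one]

theorem isTaut_tOne : IsTaut tOne := fun _ => rfl

theorem isTaut_refl : IsTaut (tImp x₀ x₀) := by simp [isTaut_imp]

theorem isTaut_weaken : IsTaut (tImp x₀ (tImp x₁ x₀)) := by
  simp only [isTaut_imp, realize_std_imp, le_prodImp, Term.realize_var]
  exact fun w => icc_mul_le_left _ _

theorem isTaut_pair : IsTaut (tImp x₀ (tImp x₁ (tMeet x₀ x₁))) := by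
  simp only [isTaut_imp, realize_std_imp, realize_std_meet, le_prodImp, Term.realize_var,
    le_inf_iff]
  exact fun w => ⟨icc_mul_le_left _ _, icc_mul_le_right _ _⟩

theorem isTaut_meet_left : IsTaut (tImp (tMeet x₀ x₁) x₀) := by simp [isTaut_imp]
theorem isTaut_meet_right : IsTaut (tImp (tMeet x₀ x₁) x₁) := by simp [isTaut_imp]

theorem isTaut_trans : IsTaut (tImp (tImp x₀ x₁) (tImp (tImp x₁ x₂) (tImp x₀ x₂))) := by
  simp only [isTaut_imp, realize_std_imp, le_prodImp, Term.realize_var]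
  intro w
  calc _ = prodImp (w 1) (w 2) * (prodImp (w 0) (w 1) * w 0) := by ac_rfl
    _ ≤ prodImp (w 1) (w 2) * w 1 := icc_mul_le_mul le_rfl (prodImp_mul_le _ _)
    _ ≤ w 2 := prodImp_mul_le _ _

theorem isTaut_trans' : IsTaut (tImp (tImp x₁ x₂) (tImp (tImp x₀ x₁) (tImp x₀ x₂))) := by
  simp only [isTaut_imp, realize_std_imp, le_prodImp, Term.realize_var]
  intro w
  calc _ = prodImp (w 1) (w 2) * (prodImp (w 0) (w 1) * w 0) := by ac_rfl
    _ ≤ prodImp (w 1) (w 2) * w 1 := icc_mul_le_mul le_rfl (prodImp_mul_le _ _)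
    _ ≤ w 2 := prodImp_mul_le _ _

theorem isTaut_mul_left : IsTaut (tImp (tImp x₀ x₁) (tImp (tMul x₀ x₂) (tMul x₁ x₂))) := by
  simp only [isTaut_imp, realize_std_imp, realize_std_mul, le_prodImp, Term.realize_var]
  intro w
  rw [← mul_assoc]
  exact icc_mul_le_mul (prodImp_mul_le _ _) le_rfl

theorem isTaut_mul_right : IsTaut (tImp (tImp x₀ x₁) (tImp (tMul x₂ x₀) (tMul x₂ x₁))) := by
  simp only [isTaut_imp, realize_std_imp, realize_std_mul, le_prodImp, Term.realize_var]
  intro w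
  rw [mul_left_comm]
  exact icc_mul_le_mul le_rfl (prodImp_mul_le _ _)

theorem isTaut_meet_left_mono :
    IsTaut (tImp (tImp x₀ x₁) (tImp (tMeet x₀ x₂) (tMeet x₁ x₂))) := by
  simp only [isTaut_imp, realize_std_imp, realize_std_meet, le_prodImp, Term.realize_var,
    le_inf_iff]
  exact fun w => ⟨(icc_mul_le_mul le_rfl (min_le_left _ _)).trans (prodImp_mul_le _ _),
    (icc_mul_le_right _ _).trans (min_le_right _ _)⟩

theorem isTaut_meet_right_mono :
    IsTaut (tImp (tImp x₀ x₁) (tImp (tMeet x₂ x₀) (tMeet x₂ x₁))) := by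
  simp only [isTaut_imp, realize_std_imp, realize_std_meet, le_prodImp, Term.realize_var,
    le_inf_iff]
  exact fun w => ⟨(icc_mul_le_right _ _).trans (min_le_left _ _),
    (icc_mul_le_mul le_rfl (min_le_right _ _)).trans (prodImp_mul_le _ _)⟩

theorem isTaut_join_left_mono :
    IsTaut (tImp (tImp x₀ x₁) (tImp (tJoin x₀ x₂) (tJoin x₁ x₂))) := by
  simp only [isTaut_imp, realize_std_imp, realize_std_join, le_prodImp, Term.realize_var]
  intro w
  rcases le_total (w 0) (w 2) with h | h
  · rw [max_eq_right h]; exact (icc_mul_le_right _ _).trans (le_max_right _ _)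
  · rw [max_eq_left h]; exact (prodImp_mul_le _ _).trans (le_max_left _ _)

theorem isTaut_join_right_mono :
    IsTaut (tImp (tImp x₀ x₁) (tImp (tJoin x₂ x₀) (tJoin x₂ x₁))) := by
  simp only [isTaut_imp, realize_std_imp, realize_std_join, le_prodImp, Term.realize_var]
  intro w
  rcases le_total (w 2) (w 0) with h | h
  · rw [max_eq_right h]; exact (prodImp_mul_le _ _).trans (le_max_right _ _)
  · rw [max_eq_left h]; exact (icc_mul_le_right _ _).trans (le_max_left _ _)

/-- With powers aᵐ and aⁿ in place of x₀ and x₁, this is closure of the theory generated by `a`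
under modus ponens. -/
theorem isTaut_deduction :
    IsTaut (tImp (tImp x₀ x₂) (tImp (tImp x₁ (tImp x₂ x₃)) (tImp (tMul x₀ x₁) x₃))) := by
  simp only [isTaut_imp, realize_std_imp, realize_std_mul, le_prodImp, Term.realize_var]
  intro w
  calc _ = (prodImp (w 1) (prodImp (w 2) (w 3)) * w 1) * (prodImp (w 0) (w 2) * w 0) := by ac_rfl
    _ ≤ prodImp (w 2) (w 3) * w 2 := icc_mul_le_mul (prodImp_mul_le _ _) (prodImp_mul_le _ _)
    _ ≤ w 3 := prodImp_mul_le _ _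

theorem isTaut_pow_add (m n : ℕ) :
    IsTaut (tImp (tPow x₀ (m + n)) (tMul (tPow x₀ m) (tPow x₀ n))) := by
  simp [isTaut_imp, pow_add]

/-- One of the two implications between x₀ and x₁ has value 1, as have its powers, so the
corresponding premise reduces to x₂ or x₃. This is what forces maximal theories to be linear. -/
theorem isTaut_prelinear (m n : ℕ) :
    IsTaut (tImp (tImp (tPow (tImp x₀ x₁) m) x₂)
      (tImp (tImp (tPow (tImp x₁ x₀) n) x₃) (tJoin x₂ x₃))) := by
  simp only [isTaut_imp, realize_std_imp, realize_std_join, realize_std_pow, le_prodImp,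
    Term.realize_var]
  intro w
  rcases le_total (w 0) (w 1) with h | h
  · rw [prodImp_eq_one.2 h, one_pow]
    refine (icc_mul_le_left _ _).trans (le_trans ?_ (le_max_left _ _))
    simpa using prodImp_mul_le 1 (w 2)
  · rw [prodImp_eq_one.2 h, one_pow]
    refine (icc_mul_le_right _ _).trans (le_trans ?_ (le_max_right _ _))
    simpa using prodImp_mul_le 1 (w 3)

/-- This law and the next two show that the set of formulas to be avoided by a prime theory is
closed under joins. -/
theorem isTaut_join_assoc :
    IsTaut (tImp (tJoin (tJoin x₀ x₁) x₂) (tJoin x₀ (tJoin x₁ x₂))) := by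
  simp only [isTaut_imp, realize_std_join, Term.realize_var]
  exact fun w => (max_assoc _ _ _).le

theorem isTaut_join_left_comm :
    IsTaut (tImp (tJoin x₀ (tJoin x₁ x₂)) (tJoin x₁ (tJoin x₀ x₂))) := by
  simp only [isTaut_imp, realize_std_join, Term.realize_var]
  exact fun w => (max_left_comm _ _ _).le

theorem isTaut_join_left_idem :
    IsTaut (tImp (tJoin x₀ (tJoin x₀ x₁)) (tJoin x₀ x₁)) := by
  simp [isTaut_imp, realize_std_join, Term.realize_var]

theorem isTaut_join_idem : IsTaut (tImp (tJoin x₀ x₀) x₀) := by simp [isTaut_imp]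
theorem isTaut_join_inl : IsTaut (tImp x₀ (tJoin x₀ x₁)) := by simp [isTaut_imp]
theorem isTaut_join_inr : IsTaut (tImp x₁ (tJoin x₀ x₁)) := by simp [isTaut_imp]

/-! ### Theories and their Lindenbaum algebras -/

/-- A set of formulas that contains the substitution instances of tautologies and the bookkeeping
axioms, and is closed under modus ponens. -/
structure IsTheory (T : Set (RBL.Term ℕ)) : Prop where
  taut : ∀ t, IsTaut t → ∀ σ : ℕ → RBL.Term ℕ, (blIncl.onTerm t).subst σ ∈ T
  mul_const : ∀ p q : RatUnit, tIff (tMul (tConst p) (tConst q)) (tConst (p * q)) ∈ T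
  imp_const : ∀ p q : RatUnit, tIff (tImp (tConst p) (tConst q)) (tConst (prodImp p q)) ∈ T
  zero_const : tIff (tConst (0 : RatUnit)) tZero ∈ T
  one_const : tIff (tConst (1 : RatUnit)) tOne ∈ T
  mp : ∀ s t, s ∈ T → tImp s t ∈ T → t ∈ T

namespace IsTheory

variable {T : Set (RBL.Term ℕ)} (hT : IsTheory T) {s t r : RBL.Term ℕ}
include hT

theorem refl (s : RBL.Term ℕ) : tImp s s ∈ T := by
  simpa using hT.taut _ isTaut_refl (asg s s s s)

theorem one_mem : tOne ∈ T := by simpa using hT.taut _ isTaut_tOne Term.var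

theorem weaken (h : s ∈ T) (t : RBL.Term ℕ) : tImp t s ∈ T :=
  hT.mp _ _ h (by simpa using hT.taut _ isTaut_weaken (asg s t s s))

theorem trans (h : tImp s t ∈ T) (h' : tImp t r ∈ T) : tImp s r ∈ T :=
  hT.mp _ _ h' (hT.mp _ _ h (by simpa using hT.taut _ isTaut_trans (asg s t r r)))

theorem tIff_mem : tIff s t ∈ T ↔ tImp s t ∈ T ∧ tImp t s ∈ T := by
  refine ⟨fun h => ⟨hT.mp _ _ h ?_, hT.mp _ _ h ?_⟩, fun h => hT.mp _ _ h.2 (hT.mp _ _ h.1 ?_)⟩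
  · simpa [tIff] using hT.taut _ isTaut_meet_left (asg (tImp s t) (tImp t s) s t)
  · simpa [tIff] using hT.taut _ isTaut_meet_right (asg (tImp s t) (tImp t s) s t)
  · simpa [tIff] using hT.taut _ isTaut_pair (asg (tImp s t) (tImp t s) s t)

theorem meet_mono {s' t' : RBL.Term ℕ} (h : tImp s s' ∈ T) (h' : tImp t t' ∈ T) :
    tImp (tMeet s t) (tMeet s' t') ∈ T :=
  hT.trans (hT.mp _ _ h (by simpa using hT.taut _ isTaut_meet_left_mono (asg s s' t t)))
    (hT.mp _ _ h' (by simpa using hT.taut _ isTaut_meet_right_mono (asg t t' s' s')))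

theorem join_mono {s' t' : RBL.Term ℕ} (h : tImp s s' ∈ T) (h' : tImp t t' ∈ T) :
    tImp (tJoin s t) (tJoin s' t') ∈ T :=
  hT.trans (hT.mp _ _ h (by simpa using hT.taut _ isTaut_join_left_mono (asg s s' t t)))
    (hT.mp _ _ h' (by simpa using hT.taut _ isTaut_join_right_mono (asg t t' s' s')))

theorem mul_mono {s' t' : RBL.Term ℕ} (h : tImp s s' ∈ T) (h' : tImp t t' ∈ T) :
    tImp (tMul s t) (tMul s' t') ∈ T :=
  hT.trans (hT.mp _ _ h (by simpa using hT.taut _ isTaut_mul_left (asg s s' t t)))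
    (hT.mp _ _ h' (by simpa using hT.taut _ isTaut_mul_right (asg t t' s' s')))

theorem imp_mono {s' t' : RBL.Term ℕ} (h : tImp s' s ∈ T) (h' : tImp t t' ∈ T) :
    tImp (tImp s t) (tImp s' t') ∈ T :=
  hT.trans (hT.mp _ _ h (by simpa using hT.taut _ isTaut_trans (asg s' s t t)))
    (hT.mp _ _ h' (by simpa using hT.taut _ isTaut_trans' (asg s' t t' t')))

/-- Provable equivalence in `T`. -/
def setoid : Setoid (RBL.Term ℕ) where
  r s t := tImp s t ∈ T ∧ tImp t s ∈ T
  iseqv := ⟨fun s => ⟨hT.refl s, hT.refl s⟩, fun h => ⟨h.2, h.1⟩,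
    fun h h' => ⟨hT.trans h.1 h'.1, hT.trans h'.2 h.2⟩⟩

end IsTheory

/-- The absolutely free algebra. -/
@[reducible]
def termStructure : RBL.Structure (RBL.Term ℕ) where
  funMap f ts := .func f ts
  RelMap r := Empty.elim r

theorem realize_termStructure (t : RBL.Term ℕ) (σ : ℕ → RBL.Term ℕ) :
    @Term.realize RBL _ termStructure _ σ t = t.subst σ := by
  induction t with
  | var x => rfl
  | func f ts ih =>
    simp only [Term.realize, Term.subst]
    exact congrArg _ (funext ih)

/-- The absolutely free algebra, compatible with provable equivalence in `T`. -/
@[reducible]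
def IsTheory.prestructure {T : Set (RBL.Term ℕ)} (hT : IsTheory T) :
    RBL.Prestructure hT.setoid where
  toStructure := termStructure
  rel_equiv := fun {_} r => Empty.elim r
  fun_equiv := by
    intro n f x y h
    have h2 : ∀ ts : Fin 2 → RBL.Term ℕ, ts = ![ts 0, ts 1] := fun ts => by
      funext i; fin_cases i <;> rfl
    change BLFunc RatUnit n at f
    cases f with
    | zero => rw [Subsingleton.elim x y]
    | one => rw [Subsingleton.elim x y]
    | const c => rw [Subsingleton.elim x y]
    | meet =>
      rw [h2 x, h2 y]
      exact ⟨hT.meet_mono (h 0).1 (h 1).1, hT.meet_mono (h 0).2 (h 1).2⟩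
    | join =>
      rw [h2 x, h2 y]
      exact ⟨hT.join_mono (h 0).1 (h 1).1, hT.join_mono (h 0).2 (h 1).2⟩
    | mul =>
      rw [h2 x, h2 y]
      exact ⟨hT.mul_mono (h 0).1 (h 1).1, hT.mul_mono (h 0).2 (h 1).2⟩
    | imp =>
      rw [h2 x, h2 y]
      exact ⟨hT.imp_mono (h 0).2 (h 1).1, hT.imp_mono (h 0).1 (h 1).2⟩

/-- The Lindenbaum algebra of a theory. -/
def IsTheory.Lindenbaum {T : Set (RBL.Term ℕ)} (hT : IsTheory T) : Type := Quotient hT.setoid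

namespace IsTheory

variable {T : Set (RBL.Term ℕ)} (hT : IsTheory T)

/-- The class of a formula in the Lindenbaum algebra. -/
def cls (t : RBL.Term ℕ) : hT.Lindenbaum := Quotient.mk hT.setoid t

instance : RBL.Structure hT.Lindenbaum :=
  letI := hT.prestructure
  inferInstanceAs (RBL.Structure (Quotient hT.setoid))

theorem exists_lift (w : ℕ → hT.Lindenbaum) : ∃ σ : ℕ → RBL.Term ℕ, w = fun n => hT.cls (σ n) :=
  ⟨fun n => (w n).out, funext fun n => (Quotient.out_eq (w n)).symm⟩

theorem realize_cls (t : RBL.Term ℕ) (σ : ℕ → RBL.Term ℕ) :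
    t.realize (fun n => hT.cls (σ n)) = hT.cls (t.subst σ) := by
  let _ := hT.prestructure
  rw [← realize_termStructure]
  exact Term.realize_quotient_mk' hT.setoid t σ

theorem cls_eq_cls {s t : RBL.Term ℕ} : hT.cls s = hT.cls t ↔ tImp s t ∈ T ∧ tImp t s ∈ T :=
  Quotient.eq (r := hT.setoid)

theorem cls_eq_one {s : RBL.Term ℕ} : hT.cls s = opOne hT.Lindenbaum ↔ s ∈ T := by
  have h1 : opOne hT.Lindenbaum = hT.cls tOne := by
    rw [← realize_tOne (A := hT.Lindenbaum) (fun n => hT.cls (.var n)), realize_cls, subst_tOne]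
  rw [h1, cls_eq_cls]
  exact ⟨fun h => hT.mp _ _ hT.one_mem h.2, fun h => ⟨hT.weaken hT.one_mem _, hT.weaken h _⟩⟩

theorem holds_of_tIff_mem {e : Eqn RBL ℕ} {σ : ℕ → RBL.Term ℕ}
    (h : (tIff e.1 e.2).subst σ ∈ T) : Eqn.Holds (fun n => hT.cls (σ n)) e := by
  rw [Eqn.Holds, realize_cls, realize_cls, cls_eq_cls, ← hT.tIff_mem]
  simpa using h

/-- Assignments lift to substitutions, so an equation is valid once all substitution instances of
the corresponding equivalence lie in `T`. An equation of the standard algebra yields a tautology,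
and the bookkeeping axioms are closed formulas. -/
theorem isRationalProductAlgebra : IsRationalProductAlgebra hT.Lindenbaum := by
  have key : ∀ e : Eqn RBL ℕ, (∀ σ, (tIff e.1 e.2).subst σ ∈ T) →
      Eqn.Valid hT.Lindenbaum e := fun e h w => by
    obtain ⟨σ, rfl⟩ := hT.exists_lift w
    exact hT.holds_of_tIff_mem (h σ)
  refine ⟨?_, fun p q => key _ ?_, fun p q => key _ ?_, key _ ?_, key _ ?_⟩
  · intro e he
    have h := key (blIncl.onTerm e.1, blIncl.onTerm e.2) (fun σ => by
      have : IsTaut (tIff e.1 e.2) := fun w => by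
        have := he w
        rw [Eqn.Holds] at this
        simp [tIff, this, prodImp_eq_one.2 le_rfl]
      simpa using hT.taut _ this σ)
    intro w
    let _ : BL.Structure hT.Lindenbaum := blIncl.reduct _
    have := h w
    rw [Eqn.Holds, LHom.realize_onTerm, LHom.realize_onTerm] at this
    exact this
  · simpa using hT.mul_const p q
  · simpa using hT.imp_const p q
  · simpa using hT.zero_const
  · simpa using hT.one_const

end IsTheory

/-! ### Prime theories -/

/-- The theory generated by `T` and `a`. -/
def adjoin (T : Set (RBL.Term ℕ)) (a : RBL.Term ℕ) : Set (RBL.Term ℕ) :=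
  {s | ∃ n, tImp (tPow a n) s ∈ T}

theorem IsTheory.subset_adjoin {T : Set (RBL.Term ℕ)} (hT : IsTheory T) (a : RBL.Term ℕ) :
    T ⊆ adjoin T a := fun _ hs => ⟨0, hT.weaken hs _⟩

theorem IsTheory.mem_adjoin {T : Set (RBL.Term ℕ)} (hT : IsTheory T) (a : RBL.Term ℕ) :
    a ∈ adjoin T a :=
  ⟨1, by simpa using hT.taut (tImp (tPow (.var 0) 1) (.var 0)) (by simp [isTaut_imp]) (asg a a a a)⟩

theorem IsTheory.adjoin {T : Set (RBL.Term ℕ)} (hT : IsTheory T) (a : RBL.Term ℕ) :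
    IsTheory (adjoin T a) where
  taut t ht σ := hT.subset_adjoin a (hT.taut t ht σ)
  mul_const p q := hT.subset_adjoin a (hT.mul_const p q)
  imp_const p q := hT.subset_adjoin a (hT.imp_const p q)
  zero_const := hT.subset_adjoin a hT.zero_const
  one_const := hT.subset_adjoin a hT.one_const
  mp := by
    rintro s t ⟨m, hm⟩ ⟨n, hn⟩
    refine ⟨m + n, hT.trans
      (by simpa using hT.taut _ (isTaut_pow_add m n) (asg a a a a)) ?_⟩
    exact hT.mp _ _ hn (hT.mp _ _ hm
      (by simpa using hT.taut _ isTaut_deduction (asg (tPow a m) (tPow a n) s t)))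

theorem IsTheory.sUnion {c : Set (Set (RBL.Term ℕ))} (hc : IsChain (· ⊆ ·) c) (hne : c.Nonempty)
    (h : ∀ T ∈ c, IsTheory T) : IsTheory (⋃₀ c) := by
  obtain ⟨T, hT⟩ := hne
  have hs : T ⊆ ⋃₀ c := Set.subset_sUnion_of_mem hT
  refine ⟨fun t ht σ => hs ((h T hT).taut t ht σ), fun p q => hs ((h T hT).mul_const p q),
    fun p q => hs ((h T hT).imp_const p q), hs (h T hT).zero_const, hs (h T hT).one_const, ?_⟩
  rintro s t ⟨T₁, h₁, hs⟩ ⟨T₂, h₂, ht⟩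
  rcases hc.total h₁ h₂ with hle | hle
  · exact ⟨T₂, h₂, (h _ h₂).mp _ _ (hle hs) ht⟩
  · exact ⟨T₁, h₁, (h _ h₁).mp _ _ hs (hle ht)⟩

/-- A formula outside a theory is outside some linear extension, which moreover avoids all formulas
`ψ` with `ψ ∨ z ▷ z` for all `z`. -/
theorem IsTheory.exists_prime {T₀ : Set (RBL.Term ℕ)} (h₀ : IsTheory T₀) {φ : RBL.Term ℕ}
    (hφ : φ ∉ T₀) : ∃ T, IsTheory T ∧ T₀ ⊆ T ∧ φ ∉ T ∧
      (∀ s t, tImp s t ∈ T ∨ tImp t s ∈ T) ∧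
      ∀ ψ, (∀ z, tJoin ψ z ∈ T₀ → z ∈ T₀) → ψ ∉ T := by
  -- Avoiding φ alone would not exclude the other formulas. This set contains φ, contains every ψ
  -- with ψ ∨ z ▷ z, is disjoint from `T₀`, and is closed under joins; `T` is taken maximal among
  -- the theories disjoint from it.
  let I : Set (RBL.Term ℕ) := {ψ | ∀ z, tJoin ψ z ∈ T₀ → tJoin φ z ∈ T₀}
  have hI : ∀ ψ ∈ I, ψ ∉ T₀ := fun ψ hψ h => by
    have h1 := h₀.mp _ _ h (by simpa using h₀.taut _ isTaut_join_inl (asg ψ φ φ φ))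
    exact hφ (h₀.mp _ _ (hψ _ h1) (by simpa using h₀.taut _ isTaut_join_idem (asg φ φ φ φ)))
  have hjoin : ∀ i ∈ I, ∀ j ∈ I, tJoin i j ∈ I := fun i hi j hj z h => by
    have h1 := hi _ (h₀.mp _ _ h (by simpa using h₀.taut _ isTaut_join_assoc (asg i j z z)))
    have h2 := hj _ (h₀.mp _ _ h1 (by simpa using h₀.taut _ isTaut_join_left_comm (asg φ j z z)))
    exact h₀.mp _ _ h2 (by simpa using h₀.taut _ isTaut_join_left_idem (asg φ z z z))
  obtain ⟨T, hT₀, hmax⟩ := zorn_subset_nonempty {T | IsTheory T ∧ ∀ ψ ∈ I, ψ ∉ T}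
    (fun c hc hchain hne => ⟨⋃₀ c, ⟨IsTheory.sUnion hchain hne fun T hT => (hc hT).1, by
      rintro ψ hψ ⟨T, hT, h⟩
      exact (hc hT).2 ψ hψ h⟩, fun _ => Set.subset_sUnion_of_mem⟩) T₀ ⟨h₀, hI⟩
  have hT := hmax.prop.1
  have hTI := hmax.prop.2
  -- By maximality, adjoining a new formula must produce a member of `I`.
  have hadj : ∀ a, a ∉ T → ∃ n, ∃ i ∈ I, tImp (tPow a n) i ∈ T := fun a ha => by
    by_contra! hcon
    refine ha (hmax.le_of_ge (y := RPL.adjoin T a) ⟨hT.adjoin a, ?_⟩ (hT.subset_adjoin a)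
      (hT.mem_adjoin a))
    rintro ψ hψ ⟨n, hn⟩
    exact hcon n ψ hψ hn
  refine ⟨T, hT, hT₀, hTI φ fun z => id, fun s t => ?_, fun ψ hψ => hTI ψ fun z hz => ?_⟩
  -- If both implications were missing, powers of them would imply some i and j in `I`; prelinearity
  -- would put i ∨ j, again a member of `I`, into `T`.
  · by_contra! hcon
    obtain ⟨m, i, hi, hm⟩ := hadj _ hcon.1
    obtain ⟨n, j, hj, hn⟩ := hadj _ hcon.2
    exact hTI _ (hjoin i hi j hj) (hT.mp _ _ hn (hT.mp _ _ hm
      (by simpa using hT.taut _ (isTaut_prelinear m n) (asg s t i j))))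
  · exact h₀.mp _ _ (hψ z hz) (by simpa using h₀.taut _ isTaut_join_inr (asg φ z z z))

theorem icc_nonneg (x : Set.Icc (0 : ℝ) 1) : 0 ≤ x := x.2.1
theorem icc_le_one (x : Set.Icc (0 : ℝ) 1) : x ≤ 1 := x.2.2

/-! ### Rational product chains and ordered groups -/

namespace IsRationalProductAlgebra

variable {A : Type u} [RBL.Structure A] (hA : IsRationalProductAlgebra A)


include hA

/-! ### Identities inherited from the standard product algebra and the bookkeeping axioms -/

theorem meet_comm (a b : A) : opMeet a b = opMeet b a := by
  simpa using hA.eq_of_standard (s := tMeet x₀ x₁) (t := tMeet x₁ x₀)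
    (fun w => by simp [min_comm]) (asg a b b b)

theorem meet_assoc (a b c : A) : opMeet (opMeet a b) c = opMeet a (opMeet b c) := by
  simpa using hA.eq_of_standard (s := tMeet (tMeet x₀ x₁) x₂) (t := tMeet x₀ (tMeet x₁ x₂))
    (fun w => by simp [min_assoc]) (asg a b c c)

theorem join_comm (a b : A) : opJoin a b = opJoin b a := by
  simpa using hA.eq_of_standard (s := tJoin x₀ x₁) (t := tJoin x₁ x₀)
    (fun w => by simp [max_comm]) (asg a b b b)

theorem join_meet_self (a b : A) : opJoin a (opMeet b a) = a := by
  simpa using hA.eq_of_standard (s := tJoin x₀ (tMeet x₁ x₀)) (t := x₀)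
    (fun w => by simp) (asg a b b b)

theorem mul_comm (a b : A) : opMul a b = opMul b a := by
  simpa using hA.eq_of_standard (s := tMul x₀ x₁) (t := tMul x₁ x₀)
    (fun w => by simp [_root_.mul_comm]) (asg a b b b)

theorem mul_assoc (a b c : A) : opMul (opMul a b) c = opMul a (opMul b c) := by
  simpa using hA.eq_of_standard (s := tMul (tMul x₀ x₁) x₂) (t := tMul x₀ (tMul x₁ x₂))
    (fun w => by simp [_root_.mul_assoc]) (asg a b c c)

theorem one_mul (a : A) : opMul (opOne A) a = a := by
  simpa using hA.eq_of_standard (s := tMul tOne x₀) (t := x₀) (fun w => by simp) (asg a a a a)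

theorem zero_mul (a : A) : opMul (opZero A) a = opZero A := by
  simpa using hA.eq_of_standard (s := tMul tZero x₀) (t := tZero) (fun w => by simp) (asg a a a a)

theorem mul_meet (a b c : A) : opMul a (opMeet b c) = opMeet (opMul a b) (opMul a c) := by
  simpa using hA.eq_of_standard (s := tMul x₀ (tMeet x₁ x₂))
    (t := tMeet (tMul x₀ x₁) (tMul x₀ x₂)) (fun w => by
      have hmono : Monotone fun x => w 0 * x := fun x y h => icc_mul_le_mul le_rfl h
      simpa using hmono.map_min (a := w 1) (b := w 2)) (asg a b c c)

theorem meet_one (a : A) : opMeet a (opOne A) = a := by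
  simpa using hA.eq_of_standard (s := tMeet x₀ tOne) (t := x₀)
    (fun w => by simpa using icc_le_one (w 0)) (asg a a a a)

theorem zero_meet (a : A) : opMeet (opZero A) a = opZero A := by
  simpa using hA.eq_of_standard (s := tMeet tZero x₀) (t := tZero)
    (fun w => by simp) (asg a a a a)

theorem mul_imp_self (a b : A) : opMul a (opImp a b) = opMeet a b := by
  simpa using hA.eq_of_standard (s := tMul x₀ (tImp x₀ x₁)) (t := tMeet x₀ x₁)
    (fun w => by
      simp only [realize_std_mul, realize_std_imp, realize_std_meet, Term.realize_var]
      rcases le_total (w 0) (w 1) with h | h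
      · rw [prodImp_eq_one.2 h, mul_one, min_eq_left h]
      · rw [min_eq_right h]
        refine le_antisymm ?_ ?_
        · rw [_root_.mul_comm]; exact prodImp_mul_le _ _
        · by_cases h0 : (w 0).1 = 0
          · exact h.trans ((show w 0 ≤ 0 from h0.le).trans (icc_nonneg _))
          · refine Subtype.coe_le_coe.1 ?_
            show (w 1).1 ≤ (w 0).1 * (if (w 0).1 ≤ (w 1).1 then 1 else (w 1).1 / (w 0).1)
            split_ifs with h'
            · simpa using h
            · rw [mul_div_cancel₀ _ h0]) (asg a b b b)

theorem meet_imp (a b : A) : opImp (opMeet a b) b = opOne A := by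
  simpa using hA.eq_of_standard (s := tImp (tMeet x₀ x₁) x₁) (t := tOne)
    isTaut_meet_right (asg a b b b)

theorem one_imp (a : A) : opImp (opOne A) a = a := by
  rw [← hA.one_mul (opImp _ _), hA.mul_imp_self, hA.meet_comm, hA.meet_one]

/-- In [0,1] a nonzero factor c cancels, and for c = 0 the antecedent ¬¬c is 0. The double negation
thus encodes the side condition c ≠ 0 equationally. -/
theorem cancel_taut (a b c : A) : opImp (opImp (opImp c (opZero A)) (opZero A))
    (opImp (opImp (opMul a c) (opMul b c)) (opImp a b)) = opOne A := by
  simpa using hA.eq_of_standard (s := tImp (tImp (tImp x₂ tZero) tZero)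
    (tImp (tImp (tMul x₀ x₂) (tMul x₁ x₂)) (tImp x₀ x₁))) (t := tOne)
    (isTaut_imp.2 fun w => by
      simp only [realize_std_imp, realize_std_mul, realize_std_zero, le_prodImp, Term.realize_var]
      by_cases h : (w 2).1 = 0
      · have h1 : prodImp (prodImp (w 2) 0) 0 = 0 := by
          rw [prodImp_eq_one.2 (show w 2 ≤ 0 from h.le)]
          have := prodImp_mul_le 1 (0 : Set.Icc (0 : ℝ) 1)
          rw [mul_one] at this
          exact le_antisymm this (icc_nonneg _)
        rw [h1, MulZeroClass.zero_mul, MulZeroClass.zero_mul]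
        exact (w 1).2.1
      · have h1 := prodImp_mul_le (w 0 * w 2) (w 1 * w 2)
        have h2 : ((prodImp (w 0 * w 2) (w 1 * w 2)) * w 0).1 * (w 2).1 ≤ (w 1).1 * (w 2).1 := by
          rw [← _root_.mul_assoc] at h1; exact h1
        have h3 := le_of_mul_le_mul_right h2 (lt_of_le_of_ne (w 2).2.1 (Ne.symm h))
        rw [_root_.mul_assoc]
        exact (icc_mul_le_right _ _).trans h3) (asg a b c c)

theorem meet_neg (a : A) : opMeet a (opImp a (opZero A)) = opZero A := by
  simpa using hA.eq_of_standard (s := tMeet x₀ (tImp x₀ tZero)) (t := tZero)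
    (fun w => by
      simp only [realize_std_meet, realize_std_imp, realize_std_zero, Term.realize_var]
      by_cases h : (w 0).1 = 0
      · rw [show w 0 = 0 from Subtype.ext h]
        exact min_eq_left (icc_nonneg _)
      · have : prodImp (w 0) 0 = 0 := by
          refine Subtype.ext ?_
          show (if (w 0).1 ≤ 0 then 1 else 0 / (w 0).1) = 0
          rw [if_neg (fun h' => h (le_antisymm h' (w 0).2.1)), zero_div]
        rw [this]
        exact min_eq_right (icc_nonneg _)) (asg a a a a)

theorem const_mul (p q : RatUnit) : opMul (opConst A p) (opConst A q) = opConst A (p * q) := by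
  simpa [Eqn.Holds] using hA.2.1 p q fun _ => opOne A

theorem const_imp (p q : RatUnit) :
    opImp (opConst A p) (opConst A q) = opConst A (prodImp p q) := by
  simpa [Eqn.Holds] using hA.2.2.1 p q fun _ => opOne A

theorem const_zero : opConst A 0 = opZero A := by
  simpa [Eqn.Holds] using hA.2.2.2.1 fun _ => opOne A

theorem const_one : opConst A 1 = opOne A := by
  simpa [Eqn.Holds] using hA.2.2.2.2 fun _ => opOne A

end IsRationalProductAlgebra

/-- An isomorphism of an algebra with the elements `≤ 1` of a linearly ordered commutative group
with zero. -/
structure ConeEmbedding (A : Type u) [RBL.Structure A] (Γ : Type v)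
    [LinearOrderedCommGroupWithZero Γ] where
  toFun : A → Γ
  injective : Function.Injective toFun
  le_one : ∀ a, toFun a ≤ 1
  exists_of_le_one : ∀ x ≤ 1, ∃ a, toFun a = x
  map_zero : toFun (opZero A) = 0
  map_one : toFun (opOne A) = 1
  map_meet : ∀ a b, toFun (opMeet a b) = min (toFun a) (toFun b)
  map_join : ∀ a b, toFun (opJoin a b) = max (toFun a) (toFun b)
  map_mul : ∀ a b, toFun (opMul a b) = toFun a * toFun b
  map_imp : ∀ a b, toFun (opImp a b) = if toFun a ≤ toFun b then 1 else toFun b / toFun a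

/-- The algebra is totally ordered. -/
def IsChainAlg (A : Type u) [RBL.Structure A] : Prop :=
  ∀ a b : A, opMeet a b = a ∨ opMeet b a = b

/-! ### Cancellation in chains and the group of quotients -/

section Chain

variable {A : Type u} [RBL.Structure A]

/-- The order of a totally ordered rational product algebra. -/
@[reducible]
noncomputable def chainOrder (hA : IsRationalProductAlgebra A) (hlin : IsChainAlg A) :
    LinearOrder A where
  le a b := opMeet a b = a
  le_refl a := by
    rcases hlin a a with h | h <;> exact h
  le_trans a b c hab hbc := by
    show opMeet a c = a
    rw [← hab, hA.meet_assoc, hbc]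
  le_antisymm a b hab hba := by
    rw [← hab, hA.meet_comm]; exact hba
  le_total := hlin
  toDecidableLE := Classical.decRel _

/-- The monoid of nonzero elements of a nontrivial rational product chain. -/
abbrev NonzeroElt (A : Type u) [RBL.Structure A] : Type u := {a : A // a ≠ opZero A}

/-- In a chain c ∧ ¬c = 0 makes ¬c = 0 for nonzero c, so ¬¬c = 1 and `cancel_taut` applies
unconditionally. -/
theorem chain_cancel (hA : IsRationalProductAlgebra A) (hlin : IsChainAlg A)
    {a b c : A} (hc : c ≠ opZero A) (h : opMeet (opMul a c) (opMul b c) = opMul a c) :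
    opMeet a b = a := by
  have hneg : opImp c (opZero A) = opZero A := by
    have h1 := hA.meet_neg c
    rcases hlin c (opImp c (opZero A)) with h2 | h2
    · exact absurd (h2.symm.trans h1) hc
    · rw [← h2, hA.meet_comm, h1]
  have h0 : opImp (opZero A) (opZero A) = opOne A := by
    have := hA.meet_imp (opZero A) (opZero A)
    rwa [hA.zero_meet] at this
  have h1 : opImp (opMul a c) (opMul b c) = opOne A := by
    have := hA.meet_imp (opMul a c) (opMul b c)
    rwa [h] at this
  have h2 := hA.cancel_taut a b c
  rw [hneg, h0, h1, hA.one_imp, hA.one_imp] at h2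
  rw [← hA.mul_imp_self, h2, hA.mul_comm, hA.one_mul]

theorem chain_mul_ne_zero (hA : IsRationalProductAlgebra A) (hlin : IsChainAlg A)
    {a b : A} (ha : a ≠ opZero A) (hb : b ≠ opZero A) : opMul a b ≠ opZero A := fun h => by
  have h1 : opMeet a (opZero A) = a := chain_cancel hA hlin hb (by
    rw [h, hA.zero_mul, hA.zero_meet])
  rw [hA.meet_comm, hA.zero_meet] at h1
  exact ha h1.symm

@[reducible]
noncomputable def nonzeroOrder (hA : IsRationalProductAlgebra A) (hlin : IsChainAlg A) :
    LinearOrder (NonzeroElt A) :=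
  letI := chainOrder hA hlin
  inferInstanceAs (LinearOrder {a : A // a ≠ opZero A})

@[reducible]
def nonzeroMonoid (hA : IsRationalProductAlgebra A) (hlin : IsChainAlg A)
    (h01 : opZero A ≠ opOne A) : CommMonoid (NonzeroElt A) where
  mul a b := ⟨opMul a.1 b.1, chain_mul_ne_zero hA hlin a.2 b.2⟩
  mul_assoc a b c := Subtype.ext (hA.mul_assoc _ _ _)
  one := ⟨opOne A, h01.symm⟩
  one_mul a := Subtype.ext (hA.one_mul _)
  mul_one a := Subtype.ext ((hA.mul_comm _ _).trans (hA.one_mul _))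
  mul_comm a b := Subtype.ext (hA.mul_comm _ _)

theorem nonzero_isOrderedCancelMonoid (hA : IsRationalProductAlgebra A) (hlin : IsChainAlg A)
    (h01 : opZero A ≠ opOne A) :
    letI := nonzeroOrder hA hlin
    letI := nonzeroMonoid hA hlin h01
    IsOrderedCancelMonoid (NonzeroElt A) := by
  let _ := nonzeroOrder hA hlin
  let _ := nonzeroMonoid hA hlin h01
  have hle : ∀ a b c : NonzeroElt A, b ≤ c → a * b ≤ a * c := fun a b c h => by
    change opMeet (opMul a.1 b.1) (opMul a.1 c.1) = opMul a.1 b.1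
    rw [← hA.mul_meet]
    exact congrArg _ h
  refine { mul_le_mul_left := fun b c h a => ?_, le_of_mul_le_mul_left := fun a b c h => ?_ }
  · rw [_root_.mul_comm b, _root_.mul_comm c]
    exact hle a b c h
  · change opMeet (opMul a.1 b.1) (opMul a.1 c.1) = opMul a.1 b.1 at h
    rw [hA.mul_comm a.1, hA.mul_comm a.1] at h
    exact chain_cancel hA hlin a.2 h

/-- The nonzero elements form a cancellative ordered monoid, which embeds in its Grothendieck group;
a zero is then adjoined. The image is the whole part below 1 because a quotient x / y ≤ 1 is
realized by the residuum. -/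
theorem exists_coneEmbedding (hA : IsRationalProductAlgebra A) (hlin : IsChainAlg A)
    (h01 : opZero A ≠ opOne A) :
    ∃ (Γ : Type u) (_ : LinearOrderedCommGroupWithZero Γ), Nonempty (ConeEmbedding A Γ) := by
  classical
  let _ := nonzeroOrder hA hlin
  let _ := nonzeroMonoid hA hlin h01
  have := nonzero_isOrderedCancelMonoid hA hlin h01
  let G := Algebra.GrothendieckGroup (NonzeroElt A)
  let _ : LinearOrder G :=
    inferInstanceAs (LinearOrder (Localization (⊤ : Submonoid (NonzeroElt A))))
  have : IsOrderedMonoid G :=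
    (inferInstance : IsOrderedCancelMonoid
      (Localization (⊤ : Submonoid (NonzeroElt A)))).toIsOrderedMonoid
  let f : NonzeroElt A →* G := Algebra.GrothendieckGroup.of
  have hf : ∀ x y, f x ≤ f y ↔ x ≤ y := fun x y => by
    refine (Localization.mk_le_mk (s := (⊤ : Submonoid (NonzeroElt A)))).trans ?_
    simp
  have hle : ∀ x y : NonzeroElt A, x ≤ y ↔ opMeet x.1 y.1 = x.1 := fun x y => Iff.rfl
  have hone : (1 : NonzeroElt A).1 = opOne A := rfl
  have hfrac : ∀ g : G, ∃ x y, g = f x / f y := fun g => by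
    induction g using Localization.induction_on with
    | H p => exact ⟨p.1, p.2.1, by
        have h1 : ∀ x, f x = Localization.mk x 1 := fun x =>
          (Localization.mk_one_eq_monoidOf_mk x).symm
        rw [h1, h1, Algebra.GrothendieckGroup.mk_div_mk]
        simp⟩
  let ι : A → WithZero G := fun a => if h : a = opZero A then 0 else (f ⟨a, h⟩ : G)
  have ι0 : ι (opZero A) = 0 := dif_pos rfl
  have ιne : ∀ a (h : a ≠ opZero A), ι a = (f ⟨a, h⟩ : G) := fun a h => dif_neg h
  have ιle : ∀ a b, ι a ≤ ι b ↔ opMeet a b = a := fun a b => by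
    by_cases ha : a = opZero A
    · simp [ha, ι0, hA.zero_meet]
    · rw [ιne a ha]
      by_cases hb : b = opZero A
      · rw [hb, ι0, hA.meet_comm, hA.zero_meet]
        simp [Ne.symm ha]
      · rw [ιne b hb, WithZero.coe_le_coe, hf, hle]
  have ιi : Function.Injective ι := fun a b h => by
    rw [← (ιle a b).1 h.le, hA.meet_comm, (ιle b a).1 h.ge]
  have ιmul : ∀ a b, ι (opMul a b) = ι a * ι b := fun a b => by
    by_cases ha : a = opZero A
    · simp [ha, ι0, hA.zero_mul]
    by_cases hb : b = opZero A
    · rw [hb, hA.mul_comm, hA.zero_mul, ι0, MulZeroClass.mul_zero]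
    rw [ιne a ha, ιne b hb, ιne _ (chain_mul_ne_zero hA hlin ha hb), ← WithZero.coe_mul, ← map_mul]
    rfl
  have ιone : ι (opOne A) = 1 := by
    rw [ιne _ h01.symm]
    exact congrArg _ (map_one f)
  have ιone_le : ∀ a, ι a ≤ 1 := fun a => by rw [← ιone, ιle, hA.meet_one]
  have ιimp : ∀ a b, ι (opImp a b) = if ι a ≤ ι b then 1 else ι b / ι a := fun a b => by
    split_ifs with h
    · have := hA.meet_imp a b
      rw [(ιle a b).1 h] at this
      rw [this, ιone]
    · have h1 : ι a ≠ 0 := fun h0 => h (by simp [h0])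
      have h2 : opMeet a b = b := by
        rw [hA.meet_comm, ← ιle]; exact (not_le.1 h).le
      rw [eq_div_iff h1, _root_.mul_comm, ← ιmul, hA.mul_imp_self, h2]
  refine ⟨WithZero G, inferInstance, ⟨⟨ι, ιi, ιone_le, ?_, ι0, ιone, ?_, ?_, ιmul, ιimp⟩⟩⟩
  · intro x hx
    induction x using WithZero.recZeroCoe with
    | zero => exact ⟨_, ι0⟩
    | coe g =>
      obtain ⟨x, y, rfl⟩ := hfrac g
      have h1 : f x ≤ f y := by
        rw [← div_le_one']
        rwa [← WithZero.coe_one, WithZero.coe_le_coe] at hx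
      -- The residuum y → x is x / y when x < y; when x = y both are 1.
      refine ⟨opImp y.1 x.1, ?_⟩
      have hx' : ι x.1 = (f x : G) := ιne _ x.2
      have hy' : ι y.1 = (f y : G) := ιne _ y.2
      rw [ιimp, hx', hy', WithZero.coe_div]
      split_ifs with h
      · rw [le_antisymm (WithZero.coe_le_coe.2 h1) h, div_self (by simp)]
      · rfl
  · intro a b
    rcases hlin a b with h | h
    · rw [h, min_eq_left ((ιle a b).2 h)]
    · rw [hA.meet_comm, h, min_eq_right ((ιle b a).2 h)]
  · have key : ∀ a b, opMeet a b = a → opJoin a b = b := fun a b h => by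
      have := hA.join_meet_self b a
      rw [h] at this
      rw [hA.join_comm, this]
    intro a b
    rcases hlin a b with h | h
    · rw [key a b h, max_eq_right ((ιle a b).2 h)]
    · rw [hA.join_comm, key b a h, max_eq_left ((ιle b a).2 h)]

end Chain

/-! ### The values of the constants -/

/-- The constant `1 / n`. -/
def invConst (n : ℕ) : RatUnit := ⟨1 / (n : ℚ), by positivity, by
  rcases Nat.eq_zero_or_pos n with rfl | h
  · simp
  · rw [div_le_one (by positivity)]; exact_mod_cast h⟩

theorem invConst_mul (m n : ℕ) : invConst (m * n) = invConst m * invConst n :=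
  Subtype.ext (by
    show 1 / ((m * n : ℕ) : ℚ) = 1 / (m : ℚ) * (1 / (n : ℚ))
    push_cast
    rw [div_mul_div_comm, one_mul])

theorem invConst_zero : invConst 0 = 0 := Subtype.ext (by simp [invConst])

theorem invConst_one : invConst 1 = 1 := Subtype.ext (by simp [invConst])

/-- An element of the rational unit interval as a nonnegative rational. -/
def RatUnit.toNNRat (q : RatUnit) : ℚ≥0 := ⟨q.1, q.2.1⟩

namespace ConeEmbedding

variable {A : Type u} [RBL.Structure A] {Γ : Type v} [LinearOrderedCommGroupWithZero Γ]
  (hA : IsRationalProductAlgebra A) (e : ConeEmbedding A Γ)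

theorem map_pow (a : A) (n : ℕ) : e.toFun (opPow a n) = e.toFun a ^ n := by
  induction n with
  | zero => simp [opPow, e.map_one]
  | succ n ih => rw [opPow, e.map_mul, ih, pow_succ]

include hA

theorem map_const_mul (p q : RatUnit) :
    e.toFun (opConst A (p * q)) = e.toFun (opConst A p) * e.toFun (opConst A q) := by
  rw [← hA.const_mul, e.map_mul]

theorem map_const_zero : e.toFun (opConst A 0) = 0 := by rw [hA.const_zero, e.map_zero]

theorem map_const_one : e.toFun (opConst A 1) = 1 := by rw [hA.const_one, e.map_one]

/-- For q ≠ 0 the bookkeeping axioms give c_q → c_0 = c_0 but c_0 → c_0 = c_1; identifying c_q with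
c_0 would make 0 = 1. -/
theorem map_const_ne_zero {q : RatUnit} (hq : q ≠ 0) : e.toFun (opConst A q) ≠ 0 := fun h => by
  have h1 : opConst A q = opConst A 0 := e.injective (h.trans (e.map_const_zero hA).symm)
  have h2 := hA.const_imp q 0
  have h3 := hA.const_imp 0 0
  have h4 : prodImp q 0 = 0 := Subtype.ext (by
    show (if q.1 ≤ 0 then (1 : ℚ) else 0 / q.1) = 0
    rw [if_neg fun h : q.1 ≤ 0 => hq (Subtype.ext (le_antisymm h q.2.1)), zero_div])
  rw [h1, h3, h4, prodImp_eq_one.2 le_rfl] at h2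
  have h5 := e.map_const_one hA
  rw [h2, e.map_const_zero hA] at h5
  exact zero_ne_one h5

/-- The extension of the interpretation of the constants to all nonnegative rationals. -/
noncomputable def constHom : ℚ≥0 →*₀ Γ where
  -- A rational num / den is (1 / den) / (1 / num), a quotient of two members of the unit interval.
  -- For q = 0 the divisor is the value of c_0, which is 0, and division by zero returns the desired
  -- 0.
  toFun q := e.toFun (opConst A (invConst q.den)) / e.toFun (opConst A (invConst q.num))
  map_zero' := by simp [invConst_zero, e.map_const_zero hA]
  map_one' := by simp [invConst_one, e.map_const_one hA]
  map_mul' x y := by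
    rcases eq_or_ne x 0 with rfl | hx
    · simp [invConst_zero, e.map_const_zero hA]
    rcases eq_or_ne y 0 with rfl | hy
    · simp [invConst_zero, e.map_const_zero hA]
    have hne : ∀ z : ℚ≥0, z ≠ 0 → e.toFun (opConst A (invConst z.num)) ≠ 0 := fun z hz => by
      refine e.map_const_ne_zero hA fun h => ?_
      have h1 : 1 / (z.num : ℚ) = 0 := congrArg Subtype.val h
      rw [div_eq_zero_iff] at h1
      have h2 : z.num = 0 := by simpa using h1
      exact hz ((NNRat.num_div_den z).symm.trans (by rw [h2]; simp))
    rw [div_mul_div_comm, div_eq_div_iff (hne _ (mul_ne_zero hx hy))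
      (mul_ne_zero (hne x hx) (hne y hy))]
    simp only [← e.map_const_mul hA, ← invConst_mul]
    congr 3
    have h1 := NNRat.num_div_den (x * y)
    have hd : ∀ z : ℚ≥0, (z.den : ℚ≥0) ≠ 0 := fun z => by simp
    rw [div_eq_iff (hd _)] at h1
    have h2 : ((x * y).num : ℚ≥0) * (x.den * y.den) = x.num * y.num * (x * y).den := by
      rw [h1]
      have hx1 : x * x.den = x.num := by rw [← eq_div_iff (hd _), NNRat.num_div_den]
      have hy1 : y * y.den = y.num := by rw [← eq_div_iff (hd _), NNRat.num_div_den]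
      rw [← hx1, ← hy1]
      ring
    have h3 : (x * y).num * (x.den * y.den) = x.num * y.num * (x * y).den := by exact_mod_cast h2
    rw [_root_.mul_comm, ← h3, _root_.mul_comm]

theorem constHom_toNNRat (q : RatUnit) :
    e.constHom hA q.toNNRat = e.toFun (opConst A q) := by
  show e.toFun _ / e.toFun _ = _
  rcases eq_or_ne q 0 with rfl | hq
  · have : RatUnit.toNNRat 0 = 0 := rfl
    simp [this, invConst_zero, e.map_const_zero hA]
  · have hq0 : q.toNNRat ≠ 0 := fun h => hq (Subtype.ext (congrArg NNRat.cast h : _))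
    have hnum : (q.toNNRat.num : ℚ) ≠ 0 := by simpa using hq0
    rw [div_eq_iff, ← e.map_const_mul hA]
    · congr 2
      refine Subtype.ext ?_
      show 1 / (q.toNNRat.den : ℚ) = q.1 * (1 / (q.toNNRat.num : ℚ))
      have h1 : q.1 = (q.toNNRat.num : ℚ) / q.toNNRat.den := by
        have := congrArg (NNRat.cast : ℚ≥0 → ℚ) (NNRat.num_div_den q.toNNRat)
        push_cast at this
        exact this.symm
      rw [h1]
      field_simp
    · refine e.map_const_ne_zero hA fun h => ?_
      have h1 : 1 / (q.toNNRat.num : ℚ) = 0 := congrArg Subtype.val h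
      rw [div_eq_zero_iff] at h1
      have h2 : q.toNNRat.num = 0 := by simpa using h1
      exact hq0 ((NNRat.num_div_den _).symm.trans (by rw [h2]; simp))

theorem constHom_le_one {x : ℚ≥0} (hx : x ≤ 1) : e.constHom hA x ≤ 1 := by
  have h : e.constHom hA x = e.toFun (opConst A ⟨x.1, x.2, hx⟩) :=
    e.constHom_toNNRat hA ⟨x.1, x.2, hx⟩
  rw [h]
  exact e.le_one _

/-- If x ≥ 1, then x⁻¹ ≤ 1 has value at most 1. The converse may fail, since constants can collapse
to 1; this direction is all that the transfer of strict inequalities needs. -/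
theorem lt_one_of_constHom_lt_one {x : ℚ≥0} (hx : e.constHom hA x < 1) : x < 1 := by
  by_contra! h
  have h0 : x ≠ 0 := (zero_lt_one.trans_le h).ne'
  have h1 := e.constHom_le_one hA (inv_le_one_of_one_le₀ h)
  rw [map_inv₀] at h1
  have h2 : e.constHom hA x ≠ 0 := by simpa using h0
  rw [inv_le_one₀ (zero_lt_iff.2 h2)] at h1
  exact hx.not_ge h1

end ConeEmbedding

/-! ### Solving strict monomial inequalities in the rationals -/

/-- Consistent bounds on powers of a positive number are met by a rational. -/
theorem exists_rat_of_root_bounds (P N : Finset (ℚ≥0 × ℕ)) (hP : ∀ s ∈ P, s.2 ≠ 0)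
    (hN : ∀ t ∈ N, t.2 ≠ 0) (h : ∀ s ∈ P, ∀ t ∈ N, s.1 ^ t.2 * t.1 ^ s.2 < 1) :
    ∃ r : ℚ≥0, r ≠ 0 ∧ (∀ s ∈ P, s.1 * r ^ s.2 < 1) ∧ ∀ t ∈ N, t.1 < r ^ t.2 := by
  classical
  -- The constraint a rᵏ < 1 means r < (1/a)^(1/k), and b < rˡ means b^(1/l) < r. The hypothesis
  -- compares these two real bounds after both are raised to the power kl.
  let up : ℚ≥0 × ℕ → ℝ := fun s => ((s.1 : ℝ)⁻¹) ^ ((s.2 : ℝ)⁻¹)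
  let lo : ℚ≥0 × ℕ → ℝ := fun t => (t.1 : ℝ) ^ ((t.2 : ℝ)⁻¹)
  have hup : ∀ s ∈ P, up s ^ s.2 = (s.1 : ℝ)⁻¹ := fun s hs =>
    Real.rpow_inv_natCast_pow (by positivity) (hP s hs)
  have hlo : ∀ t ∈ N, lo t ^ t.2 = (t.1 : ℝ) := fun t ht =>
    Real.rpow_inv_natCast_pow (by positivity) (hN t ht)
  have hup0 : ∀ s, s.1 ≠ 0 → 0 < up s := fun s hs => by
    have : (0 : ℝ) < s.1 := by exact_mod_cast pos_iff_ne_zero.2 hs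
    positivity
  have hlo0 : ∀ t, 0 ≤ lo t := fun t => by positivity
  -- The extra lower bound 0 makes the solution positive; pairs with coefficient 0 impose no upper
  -- bound and are filtered out.
  obtain ⟨m, hm1, hm2⟩ := Order.exists_between_finsets
    (lo := insert 0 (N.image lo)) (hi := (P.filter fun s => s.1 ≠ 0).image up) (by
      intro x hx y hy
      obtain ⟨s, hs, rfl⟩ := Finset.mem_image.1 hy
      obtain ⟨hs, hs0⟩ := Finset.mem_filter.1 hs
      rcases Finset.mem_insert.1 hx with rfl | hx
      · exact hup0 s hs0
      · obtain ⟨t, ht, rfl⟩ := Finset.mem_image.1 hx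
        have hst := h s hs t ht
        have hst' : (s.1 : ℝ) ^ t.2 * (t.1 : ℝ) ^ s.2 < 1 := by exact_mod_cast hst
        refine lt_of_pow_lt_pow_left₀ (s.2 * t.2) (hup0 s hs0).le ?_
        rw [pow_mul (up s), hup s hs, mul_comm s.2, pow_mul, hlo t ht, inv_pow, ← one_div,
          lt_div_iff₀ (pow_pos (by exact_mod_cast pos_iff_ne_zero.2 hs0) _), mul_comm]
        exact hst')
  -- A second real point below all upper bounds leaves an open interval in which to choose a
  -- rational.
  obtain ⟨m', hm1', hm2'⟩ := Order.exists_between_finsets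
    (lo := {m}) (hi := (P.filter fun s => s.1 ≠ 0).image up) (by simpa using hm2)
  have hmm : m < m' := hm1' m (by simp)
  obtain ⟨q, hq1, hq2⟩ := exists_rat_btwn hmm
  have hm0 : 0 < m := hm1 0 (by simp)
  have hq0 : 0 < q := by exact_mod_cast hm0.trans hq1
  obtain ⟨r, rfl⟩ : ∃ r : ℚ≥0, (r : ℚ) = q := ⟨⟨q, hq0.le⟩, rfl⟩
  have hr0 : r ≠ 0 := by rintro rfl; simp at hq0
  refine ⟨r, hr0, fun s hs => ?_, fun t ht => ?_⟩
  · rcases eq_or_ne s.1 0 with h0 | h0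
    · simp [h0]
    · have h1 : ((r : ℚ) : ℝ) < up s :=
        hq2.trans (hm2' _ (Finset.mem_image_of_mem _ (Finset.mem_filter.2 ⟨hs, h0⟩)))
      have h2 := pow_lt_pow_left₀ h1 (by positivity) (hP s hs)
      rw [hup s hs, ← one_div, lt_div_iff₀ (by exact_mod_cast pos_iff_ne_zero.2 h0)] at h2
      rw [mul_comm]
      exact_mod_cast h2
  · have h1 : lo t < ((r : ℚ) : ℝ) :=
      (hm1 _ (Finset.mem_insert_of_mem (Finset.mem_image_of_mem _ ht))).trans hq1
    have h2 := pow_lt_pow_left₀ h1 (hlo0 t) (hN t ht)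
    rw [hlo t ht] at h2
    exact_mod_cast h2

/-- The value of the monomial with coefficient `t.1` and exponents `t.2`. -/
def monomialValue {Γ : Type*} [CommGroupWithZero Γ] {n : ℕ} (κ : ℚ≥0 →*₀ Γ) (g : Fin n → Γ)
    (t : ℚ≥0 × (Fin n → ℤ)) : Γ := κ t.1 * ∏ i, g i ^ t.2 i

/-- The monomial without its first variable. -/
def monomialTail {n : ℕ} (t : ℚ≥0 × (Fin (n + 1) → ℤ)) : ℚ≥0 × (Fin n → ℤ) :=
  (t.1, fun i => t.2 i.succ)

/-- The product of powers of two monomials that cancels the first variable, if its exponents have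
different signs. -/
def monomialElim {n : ℕ} (s t : ℚ≥0 × (Fin (n + 1) → ℤ)) : ℚ≥0 × (Fin n → ℤ) :=
  (s.1 ^ (t.2 0).natAbs * t.1 ^ (s.2 0).natAbs,
    fun i => s.2 i.succ * (t.2 0).natAbs + t.2 i.succ * (s.2 0).natAbs)

section Monomial

variable {Γ : Type v} [CommGroupWithZero Γ] {n : ℕ} (κ : ℚ≥0 →*₀ Γ)

theorem monomialValue_succ (g : Fin (n + 1) → Γ) (t : ℚ≥0 × (Fin (n + 1) → ℤ)) :
    monomialValue κ g t =
      monomialValue κ (fun i => g i.succ) (monomialTail t) * g 0 ^ t.2 0 := by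
  simp only [monomialValue, Fin.prod_univ_succ, monomialTail]
  rw [mul_assoc, mul_comm (g 0 ^ _)]

theorem monomialValue_elim {g : Fin n → Γ} (hg : ∀ i, g i ≠ 0)
    (s t : ℚ≥0 × (Fin (n + 1) → ℤ)) : monomialValue κ g (monomialElim s t) =
      monomialValue κ g (monomialTail s) ^ (t.2 0).natAbs *
        monomialValue κ g (monomialTail t) ^ (s.2 0).natAbs := by
  simp only [monomialValue, monomialTail, monomialElim, map_mul, map_pow, mul_pow,
    ← Finset.prod_pow]
  rw [mul_mul_mul_comm, ← Finset.prod_mul_distrib]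
  congr 1
  refine Finset.prod_congr rfl fun i _ => ?_
  rw [zpow_add₀ (hg i), zpow_mul, zpow_mul, zpow_natCast, zpow_natCast]

end Monomial

/-- A finite system of strict monomial inequalities that is solvable in an ordered group is
solvable in the positive rationals (Fourier–Motzkin elimination). -/
theorem exists_rat_monomial_lt_one {Γ : Type v} [LinearOrderedCommGroupWithZero Γ]
    (κ : ℚ≥0 →*₀ Γ) (hκ : ∀ x, κ x < 1 → x < 1) :
    ∀ (n : ℕ) (g : Fin n → Γ), (∀ i, g i ≠ 0) → ∀ T : Finset (ℚ≥0 × (Fin n → ℤ)),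
      (∀ t ∈ T, monomialValue κ g t < 1) →
      ∃ r : Fin n → ℚ≥0, (∀ i, r i ≠ 0) ∧
        ∀ t ∈ T, monomialValue (MonoidWithZeroHom.id ℚ≥0) r t < 1 := by
  classical
  intro n
  induction n with
  | zero =>
    intro g _ T hT
    refine ⟨fun i => i.elim0, fun i => i.elim0, fun t ht => ?_⟩
    have := hκ t.1 (by simpa [monomialValue] using hT t ht)
    simpa [monomialValue] using this
  | succ n ih =>
    intro g hg T hT
    let P := T.filter fun t => 0 < t.2 0
    let N := T.filter fun t => t.2 0 < 0
    let Z := T.filter fun t => t.2 0 = 0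
    have hP : ∀ s ∈ P, s ∈ T ∧ s.2 0 = (s.2 0).natAbs ∧ (s.2 0).natAbs ≠ 0 := fun s hs => by
      obtain ⟨hs, hs0⟩ := Finset.mem_filter.1 hs
      exact ⟨hs, by omega, by omega⟩
    have hN : ∀ s ∈ N, s ∈ T ∧ s.2 0 = -((s.2 0).natAbs : ℤ) ∧ (s.2 0).natAbs ≠ 0 := fun s hs => by
      obtain ⟨hs, hs0⟩ := Finset.mem_filter.1 hs
      exact ⟨hs, by omega, by omega⟩
    -- The eliminated system keeps the inequalities free of the first variable and adds one for each
    -- pair with exponents of opposite sign.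
    obtain ⟨r, hr0, hr⟩ := ih (fun i => g i.succ) (fun i => hg _)
      (Z.image monomialTail ∪ (P ×ˢ N).image fun p => monomialElim p.1 p.2) (by
        intro t' ht'
        rcases Finset.mem_union.1 ht' with h | h
        · obtain ⟨t, ht, rfl⟩ := Finset.mem_image.1 h
          obtain ⟨ht, h0⟩ := Finset.mem_filter.1 ht
          have := hT t ht
          rwa [monomialValue_succ, h0, zpow_zero, mul_one] at this
        · obtain ⟨⟨s, t⟩, hst, rfl⟩ := Finset.mem_image.1 h
          obtain ⟨hs, ht⟩ := Finset.mem_product.1 hst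
          obtain ⟨hs, hs1, hs0⟩ := hP s hs
          obtain ⟨ht, ht1, ht0⟩ := hN t ht
          have h1 := hT s hs
          have h2 := hT t ht
          rw [monomialValue_succ, hs1, zpow_natCast] at h1
          rw [monomialValue_succ, ht1, zpow_neg, zpow_natCast] at h2
          rw [monomialValue_elim _ fun i => hg _]
          -- Each inequality is raised to the absolute exponent occurring in the other, so the
          -- powers of the first variable cancel in the product.
          have h3 := mul_lt_one_of_nonneg_of_lt_one_left zero_le (pow_lt_one₀ zero_le h1 ht0)
            (pow_lt_one₀ zero_le h2 hs0).le
          have h4 := pow_ne_zero (s.2 0).natAbs (pow_ne_zero (t.2 0).natAbs (hg 0))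
          rw [mul_pow, mul_pow, mul_mul_mul_comm, inv_pow, ← pow_mul, ← pow_mul,
            mul_comm (s.2 0).natAbs,
            pow_mul, mul_inv_cancel₀ h4, mul_one] at h3
          exact h3)
    -- With the other variables fixed at `r`, each remaining inequality is a bound on a power of the
    -- first variable; the eliminated inequalities say that these bounds are consistent.
    let v : (ℚ≥0 × (Fin (n + 1) → ℤ)) → ℚ≥0 × ℕ := fun s =>
      (monomialValue (MonoidWithZeroHom.id ℚ≥0) r (monomialTail s), (s.2 0).natAbs)
    have hv : ∀ s ∈ P, ∀ t ∈ N, (v s).1 ^ (v t).2 * (v t).1 ^ (v s).2 < 1 := by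
      intro s hs t ht
      have h1 := hr (monomialElim s t) (Finset.mem_union_right _
        (Finset.mem_image.2 ⟨(s, t), Finset.mem_product.2 ⟨hs, ht⟩, rfl⟩))
      rw [monomialValue_elim _ hr0] at h1
      exact h1
    obtain ⟨q, hq0, hqP, hqN⟩ := exists_rat_of_root_bounds (P.image v) (N.image v)
      (by
        intro p hp
        obtain ⟨s, hs, rfl⟩ := Finset.mem_image.1 hp
        exact (hP s hs).2.2)
      (by
        intro p hp
        obtain ⟨s, hs, rfl⟩ := Finset.mem_image.1 hp
        exact (hN s hs).2.2)
      (by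
        intro p hp p' hp'
        obtain ⟨s, hs, rfl⟩ := Finset.mem_image.1 hp
        obtain ⟨t, ht, rfl⟩ := Finset.mem_image.1 hp'
        exact hv s hs t ht)
    refine ⟨Fin.cons q r, fun i => ?_, fun t ht => ?_⟩
    · refine Fin.cases ?_ (fun i => ?_) i
      · exact hq0
      · exact hr0 i
    · rw [monomialValue_succ]
      simp only [Fin.cons_succ, Fin.cons_zero]
      rcases lt_trichotomy (t.2 0) 0 with h | h | h
      · have ht' : t ∈ N := Finset.mem_filter.2 ⟨ht, h⟩
        have h1 := hqN _ (Finset.mem_image_of_mem v ht')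
        rw [(hN t ht').2.1, zpow_neg, zpow_natCast, ← div_eq_mul_inv,
          div_lt_one₀ (pos_iff_ne_zero.2 (pow_ne_zero _ hq0))]
        exact h1
      · rw [h, zpow_zero, mul_one]
        exact hr _ (Finset.mem_union_left _
          (Finset.mem_image_of_mem _ (Finset.mem_filter.2 ⟨ht, h⟩)))
      · have ht' : t ∈ P := Finset.mem_filter.2 ⟨ht, h⟩
        have h1 := hqP _ (Finset.mem_image_of_mem v ht')
        rw [(hP t ht').2.1, zpow_natCast]
        exact h1

/-! ### Symbolic monomials -/

/-- The group with zero of monomials in `n` variables with positive rational coefficients. -/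
abbrev Sym (n : ℕ) : Type := WithZero (ℚ≥0ˣ × Multiplicative (Fin n → ℤ))

section Sym

variable {Γ : Type v} [CommGroupWithZero Γ] {n : ℕ} (κ : ℚ≥0 →*₀ Γ) (g : Fin n → Γ)
  (hg : ∀ i, g i ≠ 0)

/-- The coefficient and the exponents of a monomial. -/
def Sym.toMonomial : Sym n → ℚ≥0 × (Fin n → ℤ) :=
  fun u => WithZero.recZeroCoe (motive := fun _ => ℚ≥0 × (Fin n → ℤ)) 0
    (fun p => (p.1, p.2.toAdd)) u

/-- The value of a monomial. -/
def symVal : Sym n →*₀ Γ :=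
  WithZero.lift'
    { toFun := fun p => monomialValue κ g (p.1, p.2.toAdd)
      map_one' := by simp [monomialValue]
      map_mul' := fun p q => by
        simp only [monomialValue, Prod.fst_mul, Prod.snd_mul, Units.val_mul, map_mul, toAdd_mul,
          Pi.add_apply]
        rw [mul_mul_mul_comm, ← Finset.prod_mul_distrib]
        congr 1
        exact Finset.prod_congr rfl fun i _ => zpow_add₀ (hg i) _ _ }

theorem symVal_coe (p : ℚ≥0ˣ × Multiplicative (Fin n → ℤ)) :
    symVal κ g hg (p : Sym n) = monomialValue κ g (p.1, p.2.toAdd) := WithZero.lift'_coe _ _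

theorem monomialValue_toMonomial (u : Sym n) :
    monomialValue κ g u.toMonomial = symVal κ g hg u := by
  induction u using WithZero.recZeroCoe with
  | zero => simp [Sym.toMonomial, monomialValue]
  | coe p => rw [symVal_coe]; rfl

/-- The constant monomial. -/
def Sym.const (q : ℚ≥0) : Sym n :=
  if h : q = 0 then 0 else ((Units.mk0 q h, 1) : ℚ≥0ˣ × Multiplicative (Fin n → ℤ))

theorem symVal_const (q : ℚ≥0) : symVal κ g hg (Sym.const q) = κ q := by
  unfold Sym.const
  split_ifs with h
  · simp [h]
  · rw [symVal_coe]; simp [monomialValue]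

end Sym

theorem exists_symVal_lt_one {Γ : Type v} [LinearOrderedCommGroupWithZero Γ]
    (κ : ℚ≥0 →*₀ Γ) (hκ : ∀ x, κ x < 1 → x < 1) {n : ℕ} (g : Fin n → Γ) (hg : ∀ i, g i ≠ 0)
    (T : Finset (Sym n)) : ∃ (r : Fin n → ℚ≥0) (hr : ∀ i, r i ≠ 0),
      ∀ u ∈ T, symVal κ g hg u < 1 → symVal (MonoidWithZeroHom.id ℚ≥0) r hr u < 1 := by
  classical
  obtain ⟨r, hr, h⟩ := exists_rat_monomial_lt_one κ hκ n g hg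
    ((T.filter fun u => symVal κ g hg u < 1).image Sym.toMonomial) (by
      intro t ht
      obtain ⟨u, hu, rfl⟩ := Finset.mem_image.1 ht
      rw [monomialValue_toMonomial κ g hg]
      exact (Finset.mem_filter.1 hu).2)
  refine ⟨r, hr, fun u hu hlt => ?_⟩
  rw [← monomialValue_toMonomial]
  exact h _ (Finset.mem_image_of_mem _ (Finset.mem_filter.2 ⟨hu, hlt⟩))

/-! ### Symbolic evaluation of terms -/

/-- The rational product algebra on the rational unit interval as a cone. -/
def ratCone : ConeEmbedding RatUnit ℚ≥0 where
  toFun := RatUnit.toNNRat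
  injective a b h := Subtype.ext (congrArg (NNRat.cast : ℚ≥0 → ℚ) h : _)
  le_one a := a.2.2
  exists_of_le_one x hx := ⟨⟨x.1, x.2, hx⟩, rfl⟩
  map_zero := rfl
  map_one := rfl
  map_meet a b := (show Monotone RatUnit.toNNRat from fun _ _ h => h).map_min
  map_join a b := (show Monotone RatUnit.toNNRat from fun _ _ h => h).map_max
  map_mul a b := rfl
  map_imp a b := by
    refine NNRat.coe_injective ?_
    show (if a.1 ≤ b.1 then 1 else b.1 / a.1 : ℚ) = _
    have h : a.1 ≤ b.1 ↔ a.toNNRat ≤ b.toNNRat := Iff.rfl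
    by_cases h1 : a.toNNRat ≤ b.toNNRat
    · rw [if_pos h1, if_pos (h.2 h1)]; rfl
    · rw [if_neg h1, if_neg (fun h2 => h1 (h.1 h2))]; rfl

section Evaluation

variable {A : Type u} [RBL.Structure A] {Γ : Type v} [LinearOrderedCommGroupWithZero Γ]
  {E : Type} [CommGroupWithZero E]

/-- The larger value is nonzero, so a < b is the same as a / b < 1 and comparisons reduce to tests
against 1. -/
theorem lt_of_div_test {val : E →*₀ Γ} {ev : E →*₀ ℚ≥0} {a b : E}
    (h : val (a / b) < 1 → ev (a / b) < 1) (hab : val a < val b) : ev a < ev b := by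
  have hb : val b ≠ 0 := (zero_le.trans_lt hab).ne'
  have hb' : b ≠ 0 := fun h0 => hb (by rw [h0, map_zero])
  have hb'' : ev b ≠ 0 := by simpa using hb'
  rw [map_div₀, map_div₀, div_lt_one₀ (zero_lt_iff.2 hb), div_lt_one₀ (zero_lt_iff.2 hb'')] at h
  exact h hab

/-- Symbolic evaluation: up to finitely many strict inequalities, the symbolic value of a term is
independent of the evaluation of the symbols. -/
theorem exists_symbolic_value (hA : IsRationalProductAlgebra A) (e : ConeEmbedding A Γ)
    (val : E →*₀ Γ) (c : ℚ≥0 → E) (hc : ∀ q, val (c q) = e.constHom hA q) {α : Type}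
    (w : α → A) (t : α → E) (ht : ∀ x, val (t x) = e.toFun (w x)) (s : RBL.Term α) :
    ∃ U T : Finset E, ∀ ev : E →*₀ ℚ≥0, (∀ q, ev (c q) = q) →
      (∀ u ∈ T, val u < 1 → ev u < 1) →
      ∀ w' : α → RatUnit, (∀ x, ratCone.toFun (w' x) = ev (t x)) →
      ∃ u ∈ U, val u = e.toFun (s.realize w) ∧ ev u = ratCone.toFun (s.realize w') := by
  classical
  -- `U` collects the possible symbolic values of a term and `T` the tests. A set of candidates is
  -- needed because `ev` may break a tie of `val` either way; `U` and `T` are fixed before `ev` is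
  -- chosen.
  let quot : Finset E → Finset E → Finset E := fun U V => (U ×ˢ V).image fun p => p.1 / p.2
  have mem_quot : ∀ {U V : Finset E} {a b : E}, a ∈ U → b ∈ V → a / b ∈ quot U V := fun ha hb =>
    Finset.mem_image.2 ⟨(_, _), Finset.mem_product.2 ⟨ha, hb⟩, rfl⟩
  induction s using term_induction with
  | var x => exact ⟨{t x}, ∅, fun ev _ _ w' hw' => ⟨t x, by simp, ht x, (hw' x).symm⟩⟩
  | zero =>
    refine ⟨{0}, ∅, fun ev _ _ w' _ => ⟨0, by simp, ?_, ?_⟩⟩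
    · rw [realize_tZero, e.map_zero, map_zero]
    · rw [realize_tZero, ratCone.map_zero, map_zero]
  | one =>
    refine ⟨{1}, ∅, fun ev _ _ w' _ => ⟨1, by simp, ?_, ?_⟩⟩
    · rw [realize_tOne, e.map_one, map_one]
    · rw [realize_tOne, ratCone.map_one, map_one]
  | const q =>
    refine ⟨{c q.toNNRat}, ∅, fun ev hev _ w' _ => ⟨c q.toNNRat, by simp, ?_, ?_⟩⟩
    · rw [realize_tConst, hc, e.constHom_toNNRat hA]
    · rw [realize_tConst, hev]; rfl
  | meet s₁ s₂ ih₁ ih₂ =>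
    obtain ⟨U₁, T₁, h₁⟩ := ih₁
    obtain ⟨U₂, T₂, h₂⟩ := ih₂
    refine ⟨U₁ ∪ U₂, T₁ ∪ T₂ ∪ (quot U₁ U₂ ∪ quot U₂ U₁), fun ev hev hT w' hw' => ?_⟩
    obtain ⟨u₁, hu₁, hv₁, he₁⟩ := h₁ ev hev (fun u hu => hT u (by simp [hu])) w' hw'
    obtain ⟨u₂, hu₂, hv₂, he₂⟩ := h₂ ev hev (fun u hu => hT u (by simp [hu])) w' hw'
    have h12 := lt_of_div_test (hT (u₁ / u₂) (by simp [mem_quot hu₁ hu₂]))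
    have h21 := lt_of_div_test (hT (u₂ / u₁) (by simp [mem_quot hu₂ hu₁]))
    simp only [realize_tMeet, e.map_meet, ratCone.map_meet, ← hv₁, ← hv₂, ← he₁, ← he₂]
    rcases lt_trichotomy (val u₁) (val u₂) with h | h | h
    · exact ⟨u₁, by simp [hu₁], (min_eq_left h.le).symm, (min_eq_left (h12 h).le).symm⟩
    -- In a tie both candidates have the right value under `val`, so `ev` decides which to take.
    · rcases le_total (ev u₁) (ev u₂) with h' | h'
      · exact ⟨u₁, by simp [hu₁], by simp [h], (min_eq_left h').symm⟩
      · exact ⟨u₂, by simp [hu₂], by simp [h], (min_eq_right h').symm⟩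
    · exact ⟨u₂, by simp [hu₂], (min_eq_right h.le).symm, (min_eq_right (h21 h).le).symm⟩
  | join s₁ s₂ ih₁ ih₂ =>
    obtain ⟨U₁, T₁, h₁⟩ := ih₁
    obtain ⟨U₂, T₂, h₂⟩ := ih₂
    refine ⟨U₁ ∪ U₂, T₁ ∪ T₂ ∪ (quot U₁ U₂ ∪ quot U₂ U₁), fun ev hev hT w' hw' => ?_⟩
    obtain ⟨u₁, hu₁, hv₁, he₁⟩ := h₁ ev hev (fun u hu => hT u (by simp [hu])) w' hw'
    obtain ⟨u₂, hu₂, hv₂, he₂⟩ := h₂ ev hev (fun u hu => hT u (by simp [hu])) w' hw'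
    have h12 := lt_of_div_test (hT (u₁ / u₂) (by simp [mem_quot hu₁ hu₂]))
    have h21 := lt_of_div_test (hT (u₂ / u₁) (by simp [mem_quot hu₂ hu₁]))
    simp only [realize_tJoin, e.map_join, ratCone.map_join, ← hv₁, ← hv₂, ← he₁, ← he₂]
    rcases lt_trichotomy (val u₁) (val u₂) with h | h | h
    · exact ⟨u₂, by simp [hu₂], (max_eq_right h.le).symm, (max_eq_right (h12 h).le).symm⟩
    · rcases le_total (ev u₁) (ev u₂) with h' | h'
      · exact ⟨u₂, by simp [hu₂], by simp [h], (max_eq_right h').symm⟩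
      · exact ⟨u₁, by simp [hu₁], by simp [h], (max_eq_left h').symm⟩
    · exact ⟨u₁, by simp [hu₁], (max_eq_left h.le).symm, (max_eq_left (h21 h).le).symm⟩
  | mul s₁ s₂ ih₁ ih₂ =>
    obtain ⟨U₁, T₁, h₁⟩ := ih₁
    obtain ⟨U₂, T₂, h₂⟩ := ih₂
    refine ⟨(U₁ ×ˢ U₂).image fun p => p.1 * p.2, T₁ ∪ T₂, fun ev hev hT w' hw' => ?_⟩
    obtain ⟨u₁, hu₁, hv₁, he₁⟩ := h₁ ev hev (fun u hu => hT u (by simp [hu])) w' hw'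
    obtain ⟨u₂, hu₂, hv₂, he₂⟩ := h₂ ev hev (fun u hu => hT u (by simp [hu])) w' hw'
    refine ⟨u₁ * u₂, Finset.mem_image.2 ⟨(_, _), Finset.mem_product.2 ⟨hu₁, hu₂⟩, rfl⟩, ?_, ?_⟩
    · rw [realize_tMul, e.map_mul, map_mul, hv₁, hv₂]
    · rw [realize_tMul, ratCone.map_mul, map_mul, he₁, he₂]
  | imp s₁ s₂ ih₁ ih₂ =>
    obtain ⟨U₁, T₁, h₁⟩ := ih₁
    obtain ⟨U₂, T₂, h₂⟩ := ih₂
    refine ⟨insert 1 (quot U₂ U₁), T₁ ∪ T₂ ∪ (quot U₁ U₂ ∪ quot U₂ U₁), fun ev hev hT w' hw' => ?_⟩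
    obtain ⟨u₁, hu₁, hv₁, he₁⟩ := h₁ ev hev (fun u hu => hT u (by simp [hu])) w' hw'
    obtain ⟨u₂, hu₂, hv₂, he₂⟩ := h₂ ev hev (fun u hu => hT u (by simp [hu])) w' hw'
    have h12 := lt_of_div_test (hT (u₁ / u₂) (by simp [mem_quot hu₁ hu₂]))
    have h21 := lt_of_div_test (hT (u₂ / u₁) (by simp [mem_quot hu₂ hu₁]))
    simp only [realize_tImp, e.map_imp, ratCone.map_imp, ← hv₁, ← hv₂, ← he₁, ← he₂]
    rcases lt_trichotomy (val u₁) (val u₂) with h | h | h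
    · exact ⟨1, by simp, by rw [if_pos h.le, map_one], by rw [if_pos (h12 h).le, map_one]⟩
    -- In a tie both 1 and u₂ / u₁ have value 1 under `val`. The quotient is used only if ev u₂ < ev
    -- u₁, which also gives u₁ ≠ 0.
    · by_cases h' : ev u₁ ≤ ev u₂
      · exact ⟨1, by simp, by rw [if_pos h.le, map_one], by rw [if_pos h', map_one]⟩
      · refine ⟨u₂ / u₁, by simp [mem_quot hu₂ hu₁], ?_, by rw [if_neg h', map_div₀]⟩
        have h1 : u₁ ≠ 0 := fun h0 => h' (by simp [h0])
        rw [if_pos h.le, map_div₀, h, div_self]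
        rw [← h]
        simpa using h1
    · exact ⟨u₂ / u₁, by simp [mem_quot hu₂ hu₁], by rw [if_neg h.not_ge, map_div₀],
        by rw [if_neg (h21 h).not_ge, map_div₀]⟩

/-- An assignment represented by monomials is approximated by rational assignments, respecting
finitely many strict inequalities between values of terms. -/
theorem exists_rational_assignment (hA : IsRationalProductAlgebra A) (e : ConeEmbedding A Γ)
    {α : Type} (w : α → A) (hw : {x | w x ≠ opOne A}.Finite) {n : ℕ} (g : Fin n → Γ)
    (hg : ∀ i, g i ≠ 0) (t : α → Sym n)
    (ht : ∀ x, symVal (e.constHom hA) g hg (t x) = e.toFun (w x))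
    (ht1 : ∀ x, w x = opOne A → t x = 1) (S : Finset (RBL.Term α)) :
    ∃ (ev : Sym n →*₀ ℚ≥0) (w' : α → RatUnit) (f : RBL.Term α → Sym n),
      ∀ s ∈ S, symVal (e.constHom hA) g hg (f s) = e.toFun (s.realize w) ∧
        ev (f s) = ratCone.toFun (s.realize w') ∧
        ∀ s' ∈ S, e.toFun (s.realize w) < e.toFun (s'.realize w) →
          ratCone.toFun (s.realize w') < ratCone.toFun (s'.realize w') := by
  classical
  choose U T h using exists_symbolic_value hA e (symVal (e.constHom hA) g hg) Sym.const
    (symVal_const _ g hg) w t ht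
  let V := S.biUnion U
  -- Three families of tests: those required by symbolic evaluation, the quotients that preserve
  -- strict inequalities between terms of `S`, and the symbols of the variables, whose evaluations
  -- must lie in the unit interval.
  obtain ⟨r, hr, hT⟩ := exists_symVal_lt_one (e.constHom hA)
    (fun x => e.lt_one_of_constHom_lt_one hA) g hg
    (S.biUnion T ∪ (V ×ˢ V).image (fun p => p.1 / p.2) ∪ hw.toFinset.image t)
  -- Only strict inequalities are preserved, so a variable of value 1 could be evaluated above 1;
  -- representing it by the symbol 1 rules this out.
  have hle : ∀ x, symVal (MonoidWithZeroHom.id ℚ≥0) r hr (t x) ≤ 1 := fun x => by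
    by_cases hx : w x = opOne A
    · rw [ht1 x hx, map_one]
    · refine (hT (t x) (Finset.mem_union_right _
        (Finset.mem_image_of_mem _ (by simpa using hx))) ?_).le
      rw [ht]
      refine lt_of_le_of_ne (e.le_one _) fun h1 => hx (e.injective (h1.trans e.map_one.symm))
  choose w' hw' using fun x => ratCone.exists_of_le_one _ (hle x)
  have hex : ∀ s ∈ S, ∃ u ∈ U s, symVal (e.constHom hA) g hg u = e.toFun (s.realize w) ∧
      symVal (MonoidWithZeroHom.id ℚ≥0) r hr u = ratCone.toFun (s.realize w') := fun s hs =>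
    h s (symVal (MonoidWithZeroHom.id ℚ≥0) r hr) (symVal_const _ r hr)
      (fun u hu => hT u (Finset.mem_union_left _ (Finset.mem_union_left _
        (Finset.mem_biUnion.2 ⟨s, hs, hu⟩)))) w' hw'
  choose! f hfU hfv hfe using hex
  refine ⟨_, w', f, fun s hs => ⟨hfv s hs, hfe s hs, fun s' hs' hlt => ?_⟩⟩
  rw [← hfe s hs, ← hfe s' hs']
  rw [← hfv s hs, ← hfv s' hs'] at hlt
  refine lt_of_div_test (hT _ (Finset.mem_union_left _ (Finset.mem_union_right _ ?_))) hlt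
  exact Finset.mem_image.2 ⟨(f s, f s'), Finset.mem_product.2
    ⟨Finset.mem_biUnion.2 ⟨s, hs, hfU s hs⟩, Finset.mem_biUnion.2 ⟨s', hs', hfU s' hs'⟩⟩, rfl⟩

end Evaluation

/-! ### Representing assignments by monomials -/

/-- Finitely many elements of an abelian group are monomials in elements that are independent modulo
a pure subgroup. -/
theorem exists_basis_mod_pure {G : Type u} [CommGroup G] (D : Subgroup G)
    (hD : ∀ (g : G) (n : ℕ), n ≠ 0 → g ^ n ∈ D → g ∈ D) (V : Set G) (hV : V.Finite) :
    ∃ (n : ℕ) (g : Fin n → G),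
      (∀ v ∈ V, ∃ m : Fin n → ℤ, ∃ d ∈ D, v = d * ∏ i, g i ^ m i) ∧
      ∀ m : Fin n → ℤ, ∏ i, g i ^ m i ∈ D → m = 0 := by
  let N : Submodule ℤ (Additive (G ⧸ D)) :=
    Submodule.span ℤ ((fun v : G => Additive.ofMul (v : G ⧸ D)) '' V)
  have hfin : Module.Finite ℤ N := Module.Finite.span_of_finite ℤ (hV.image _)
  -- Purity of `D` is torsion-freeness of the quotient; a finitely generated torsion-free abelian
  -- group is free, and lifts of a basis serve as generators.
  have htf : Module.IsTorsionFree ℤ (Additive (G ⧸ D)) := by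
    refine .of_smul_eq_zero fun z x hzx => ?_
    by_contra! hne
    obtain ⟨y, hy⟩ := QuotientGroup.mk_surjective (Additive.toMul x)
    have h1 : ((y ^ z.natAbs : G) : G ⧸ D) = 1 := by
      have h2 : ((y ^ z : G) : G ⧸ D) = 1 := by
        rw [QuotientGroup.mk_zpow, hy, ← toMul_zsmul, hzx, toMul_zero]
      rcases Int.natAbs_eq z with hz | hz
      · rwa [hz, zpow_natCast] at h2
      · rw [hz, zpow_neg, zpow_natCast, QuotientGroup.mk_inv, inv_eq_one] at h2
        exact h2
    have h3 := hD y z.natAbs (Int.natAbs_ne_zero.2 hne.1) ((QuotientGroup.eq_one_iff _).1 h1)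
    refine hne.2 (Additive.toMul.injective ?_)
    rw [← hy, toMul_zero]
    exact (QuotientGroup.eq_one_iff _).2 h3
  have : Module.IsTorsionFree ℤ N := inferInstance
  have hfree : Module.Free ℤ N := inferInstance
  let b := Module.finBasis ℤ N
  choose g hg using fun i => QuotientGroup.mk_surjective (Additive.toMul (b i : Additive (G ⧸ D)))
  have hprod : ∀ m : Fin (Module.finrank ℤ N) → ℤ,
      ((∏ i, g i ^ m i : G) : G ⧸ D) =
        Additive.toMul ((∑ i, m i • b i : N) : Additive (G ⧸ D)) := by
    intro m
    rw [Submodule.coe_sum, toMul_sum]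
    refine (map_prod (QuotientGroup.mk' D) _ _).trans ?_
    refine Finset.prod_congr rfl fun i _ => ?_
    rw [map_zpow, QuotientGroup.mk'_apply, hg, Submodule.coe_smul, toMul_zsmul]
  refine ⟨_, g, fun v hv => ?_, fun m hm => ?_⟩
  · let y : N := ⟨Additive.ofMul (v : G ⧸ D), Submodule.subset_span ⟨v, hv, rfl⟩⟩
    refine ⟨fun i => b.repr y i, v / ∏ i, g i ^ (b.repr y i), ?_, by simp⟩
    rw [← QuotientGroup.eq_one_iff, QuotientGroup.mk_div, hprod, b.sum_repr]
    simp [y]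
  · rw [← QuotientGroup.eq_one_iff, hprod] at hm
    have h0 : (∑ i, m i • b i : N) = 0 := Subtype.ext hm
    exact funext (Fintype.linearIndependent_iff.1 b.linearIndependent m h0)

section Representation

variable {A : Type u} [RBL.Structure A] {Γ : Type v} [LinearOrderedCommGroupWithZero Γ]
  (hA : IsRationalProductAlgebra A) (e : ConeEmbedding A Γ)

include hA

/-- Each variable with value different from 0 and 1 becomes a generator of its own. The generators
may be dependent, which suffices when only strict inequalities are to be transferred. -/
theorem exists_monomial_representation {α : Type} (w : α → A)
    (hw : {x | w x ≠ opOne A}.Finite) :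
    ∃ (n : ℕ) (g : Fin n → Γ) (hg : ∀ i, g i ≠ 0) (t : α → Sym n),
      (∀ x, symVal (e.constHom hA) g hg (t x) = e.toFun (w x)) ∧
      ∀ x, w x = opOne A → t x = 1 := by
  classical
  let V := hw.toFinset.filter fun x => e.toFun (w x) ≠ 0
  let E := V.equivFin
  refine ⟨V.card, fun i => e.toFun (w (E.symm i)), fun i =>
    (Finset.mem_filter.1 (E.symm i).2).2, fun x =>
    if hx : x ∈ V then
      ((1, Multiplicative.ofAdd (Pi.single (E ⟨x, hx⟩) 1)) : ℚ≥0ˣ × Multiplicative (Fin V.card → ℤ))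
    else if w x = opOne A then 1 else 0, fun x => ?_, fun x h1 => ?_⟩
  · dsimp only
    split_ifs with hx h1
    · rw [symVal_coe, monomialValue, Finset.prod_eq_single (E ⟨x, hx⟩)]
      · simp
      · intro i _ hi; simp [hi]
      · simp
    · rw [map_one, h1, e.map_one]
    · have : e.toFun (w x) = 0 := by
        by_contra h0
        exact hx (Finset.mem_filter.2 ⟨by simpa using h1, h0⟩)
      rw [map_zero, this]
  · have hx : x ∉ V := fun hx => by simpa [h1] using (Finset.mem_filter.1 hx).1
    simp [hx, h1]

/-- The constants `c_p`, `p < 1`, are not `1`, and have no irrational roots. -/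
structure IsFaithful (A : Type u) [RBL.Structure A] : Prop where
  const_ne_one : ∀ q : RatUnit, q ≠ 1 → opConst A q ≠ opOne A
  root : ∀ p n, IrrationalRoot p n → ∀ a : A, opConst A p ≠ opPow a n

variable (hF : IsFaithful A)
include hF

theorem constHom_eq_one {q : ℚ≥0} (h : e.constHom hA q = 1) : q = 1 := by
  have key : ∀ q : ℚ≥0, q ≤ 1 → e.constHom hA q = 1 → q = 1 := fun q hq h => by
    by_contra hne
    have h1 : e.constHom hA q = e.toFun (opConst A ⟨q.1, q.2, hq⟩) :=
      e.constHom_toNNRat hA ⟨q.1, q.2, hq⟩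
    refine hF.const_ne_one ⟨q.1, q.2, hq⟩ (fun h2 => hne (NNRat.coe_injective ?_))
      (e.injective (h1.symm.trans (h.trans e.map_one.symm)))
    have h3 : q.1 = 1 := congrArg (fun z : RatUnit => z.1) h2
    exact h3
  rcases le_total q 1 with hq | hq
  · exact key q hq h
  · exact inv_eq_one.1 (key q⁻¹ (inv_le_one_of_one_le₀ hq) (by rw [map_inv₀, h, inv_one]))

/-- After inversion if necessary, yⁿ is the value of a constant c_p with p ≤ 1, so y ≤ 1 comes from
the algebra and is an n-th root of c_p there. Faithfulness makes the real root of p rational, and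
roots in an ordered group are unique, so y is the value of that rational. -/
theorem pure_range_constHom (y : Γˣ) (n : ℕ) (hn : n ≠ 0)
    (hy : y ^ n ∈ (Units.map (e.constHom hA : ℚ≥0 →* Γ)).range) :
    y ∈ (Units.map (e.constHom hA : ℚ≥0 →* Γ)).range := by
  have key : ∀ (y : Γˣ) (q : ℚ≥0ˣ), (q : ℚ≥0) ≤ 1 → e.constHom hA q = (y : Γ) ^ n →
      y ∈ (Units.map (e.constHom hA : ℚ≥0 →* Γ)).range := by
    intro y q hq1 hq
    have hy1 : (y : Γ) ≤ 1 := by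
      rw [← pow_le_one_iff_of_nonneg zero_le hn, ← hq]
      exact e.constHom_le_one hA hq1
    obtain ⟨a, ha⟩ := e.exists_of_le_one _ hy1
    let p : RatUnit := ⟨(q : ℚ≥0).1, (q : ℚ≥0).2, hq1⟩
    have h1 : e.constHom hA q = e.toFun (opConst A p) := e.constHom_toNNRat hA p
    have h2 : opConst A p = opPow a n := e.injective (by rw [← h1, hq, e.map_pow, ha])
    have h3 : ¬ IrrationalRoot p n := fun h => hF.root p n h a h2
    have h4 : ¬ Irrational (((p : ℚ) : ℝ) ^ ((1 : ℝ) / (n : ℝ))) := fun h =>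
      h3 ⟨Nat.one_le_iff_ne_zero.2 hn, h⟩
    obtain ⟨r, hr⟩ := not_not.1 h4
    have hp0 : (0 : ℝ) ≤ ((p : ℚ) : ℝ) := by exact_mod_cast p.2.1
    have hr0 : 0 ≤ r := by
      have : (0 : ℝ) ≤ (r : ℝ) := by rw [hr]; positivity
      exact_mod_cast this
    have hrn : (r : ℝ) ^ n = ((p : ℚ) : ℝ) := by
      rw [hr, one_div, Real.rpow_inv_natCast_pow hp0 hn]
    have hrn' : r ^ n = (p : ℚ) := by exact_mod_cast hrn
    obtain ⟨z, rfl⟩ : ∃ z : ℚ≥0, (z : ℚ) = r := ⟨⟨r, hr0⟩, rfl⟩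
    have hzq : z ^ n = q := NNRat.coe_injective (by push_cast; exact hrn')
    have hz : z ≠ 0 := fun h => q.ne_zero (by rw [← hzq, h, zero_pow hn])
    refine ⟨Units.mk0 z hz, Units.ext ?_⟩
    have h5 : e.constHom hA z ^ n = (y : Γ) ^ n := by rw [← map_pow, hzq, hq]
    exact (pow_left_inj₀ zero_le zero_le hn).1 h5
  obtain ⟨q, hq⟩ := hy
  have hq' : e.constHom hA q = (y : Γ) ^ n := congrArg Units.val hq
  rcases le_total (q : ℚ≥0) 1 with h | h
  · exact key y q h hq'
  · rw [← inv_mem_iff]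
    refine key y⁻¹ q⁻¹ ?_ ?_
    · rw [Units.val_inv_eq_inv_val]; exact inv_le_one_of_one_le₀ h
    · rw [Units.val_inv_eq_inv_val, Units.val_inv_eq_inv_val, map_inv₀, hq', inv_pow]

/-- The generators are independent modulo the constants: a monomial of value 1 has its variable part
in the image of the constants, hence has zero exponents, and its coefficient is 1 by
`constHom_eq_one`. -/
theorem exists_faithful_representation {α : Type} (w : α → A)
    (hw : {x | w x ≠ opOne A}.Finite) :
    ∃ (n : ℕ) (g : Fin n → Γ) (hg : ∀ i, g i ≠ 0) (t : α → Sym n),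
      (∀ x, symVal (e.constHom hA) g hg (t x) = e.toFun (w x)) ∧
      (∀ x, w x = opOne A → t x = 1) ∧
      ∀ u, symVal (e.constHom hA) g hg u = 1 → u = 1 := by
  classical
  obtain ⟨n, g, hg, hind⟩ := exists_basis_mod_pure
    (Units.map (e.constHom hA : ℚ≥0 →* Γ)).range (pure_range_constHom hA e hF)
    -- The entry 1 for variables of value 0 is a dummy unit; such variables are represented by the
    -- symbol 0.
    ((fun x => if h : e.toFun (w x) = 0 then 1 else Units.mk0 _ h) '' {x | w x ≠ opOne A})
    (hw.image _)
  have hval : ∀ (q : ℚ≥0ˣ) (m : Fin n → ℤ),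
      monomialValue (e.constHom hA) (fun i => (g i : Γ)) (q, m) =
      ((Units.map (e.constHom hA : ℚ≥0 →* Γ) q * ∏ i, g i ^ m i : Γˣ) : Γ) := fun q m => by
    simp [monomialValue]
  have hex : ∀ x, ∃ t : Sym n,
      symVal (e.constHom hA) (fun i => (g i : Γ)) (fun i => (g i).ne_zero) t = e.toFun (w x) ∧
      (w x = opOne A → t = 1) := fun x => by
    by_cases h1 : w x = opOne A
    · exact ⟨1, by rw [map_one, h1, e.map_one], fun _ => rfl⟩
    by_cases h0 : e.toFun (w x) = 0
    · exact ⟨0, by rw [map_zero, h0], fun h => absurd h h1⟩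
    obtain ⟨m, d, ⟨q, rfl⟩, hd⟩ := hg (Units.mk0 _ h0) ⟨x, h1, dif_neg h0⟩
    refine ⟨((q, Multiplicative.ofAdd m) : ℚ≥0ˣ × Multiplicative (Fin n → ℤ)), ?_,
      fun h => absurd h h1⟩
    rw [symVal_coe]
    refine (hval q m).trans ?_
    rw [← hd]
    rfl
  choose t ht ht1 using hex
  refine ⟨n, fun i => g i, fun i => (g i).ne_zero, t, ht, ht1, fun u hu => ?_⟩
  induction u using WithZero.recZeroCoe with
  | zero => simp at hu
  | coe p =>
    rw [symVal_coe, hval, Units.val_eq_one] at hu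
    have hm : p.2.toAdd = 0 := hind _ (by
      rw [eq_inv_of_mul_eq_one_right hu, inv_mem_iff]
      exact ⟨_, rfl⟩)
    rw [hm] at hu
    have hq : p.1 = 1 := Units.ext (constHom_eq_one hA e hF (by
      simpa [Units.ext_iff] using hu))
    have hp : p = 1 := Prod.ext hq hm
    rw [hp]
    rfl

end Representation

/-! ### Transfer between rational product chains and the rational unit interval -/

section Transfer

variable {A : Type u} [RBL.Structure A]

theorem term_realize_congr {α : Type} {M : Type v} [RBL.Structure M] [DecidableEq α]
    (s : RBL.Term α) {w w' : α → M} (h : ∀ x ∈ s.varFinset, w x = w' x) :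
    s.realize w = s.realize w' := by
  induction s with
  | var x => exact h x (by simp [Term.varFinset])
  | func f ts ih =>
    simp only [Term.realize]
    congr 1
    funext i
    exact ih i fun x hx => h x (by
      simp only [Term.varFinset, Finset.mem_biUnion]
      exact ⟨i, Finset.mem_univ _, hx⟩)

/-- Variables not occurring in `S` are reset to 1, so that only finitely many of them need a test or
a generator. -/
theorem exists_finite_assignment {α : Type} (S : Finset (RBL.Term α)) (w : α → A) :
    ∃ w₀ : α → A, {x | w₀ x ≠ opOne A}.Finite ∧ ∀ s ∈ S, s.realize w₀ = s.realize w := by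
  classical
  refine ⟨fun x => if x ∈ S.biUnion Term.varFinset then w x else opOne A,
    (S.biUnion Term.varFinset).finite_toSet.subset fun x hx => ?_, fun s hs =>
    term_realize_congr s fun x hx => if_pos (Finset.mem_biUnion.2 ⟨s, hs, hx⟩)⟩
  by_contra h
  exact hx (if_neg h)

/-- A formula that fails in a rational product chain fails in the rational unit interval. -/
theorem exists_ratUnit_ne_one (hA : IsRationalProductAlgebra A) (hlin : IsChainAlg A)
    {α : Type} (w : α → A) (s : RBL.Term α) (hs : s.realize w ≠ opOne A) :
    ∃ w' : α → RatUnit, s.realize w' ≠ opOne RatUnit := by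
  classical
  have h01 : opZero A ≠ opOne A := fun h => hs (by
    have h1 := hA.meet_one (s.realize w)
    rw [← h, hA.meet_comm, hA.zero_meet] at h1
    rw [← h1, h])
  obtain ⟨Γ, _, ⟨e⟩⟩ := exists_coneEmbedding hA hlin h01
  -- Including the term 1 turns the failure of `s` into a strict inequality between two tracked
  -- terms.
  obtain ⟨w₀, hw₀, hws⟩ := exists_finite_assignment {s, tOne} w
  obtain ⟨n, g, hg, t, ht, ht1⟩ := exists_monomial_representation hA e w₀ hw₀
  obtain ⟨ev, w', f, h⟩ := exists_rational_assignment hA e w₀ hw₀ g hg t ht ht1 {s, tOne}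
  refine ⟨w', fun h1 => ?_⟩
  have h2 := (h s (by simp)).2.2 tOne (by simp) (by
    rw [hws s (by simp), realize_tOne, e.map_one]
    exact lt_of_le_of_ne (e.le_one _) fun h => hs (e.injective (h.trans e.map_one.symm)))
  rw [h1, realize_tOne] at h2
  exact lt_irrefl _ h2

/-- Finite parts of faithful rational product chains embed into the rational unit interval. -/
theorem exists_ratUnit_assignment (hA : IsRationalProductAlgebra A) (hlin : IsChainAlg A)
    (hF : IsFaithful A) {α : Type} (w : α → A) (S : Finset (RBL.Term α)) :
    ∃ w' : α → RatUnit, ∀ s ∈ S, ∀ s' ∈ S,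
      (s.realize w = s'.realize w ↔ s.realize w' = s'.realize w') := by
  have h01 : opZero A ≠ opOne A := fun h =>
    hF.const_ne_one 0 (fun h' => zero_ne_one (congrArg Subtype.val h' : (0 : ℚ) = 1))
      (by rw [hA.const_zero, h])
  obtain ⟨Γ, _, ⟨e⟩⟩ := exists_coneEmbedding hA hlin h01
  obtain ⟨w₀, hw₀, hws⟩ := exists_finite_assignment S w
  obtain ⟨n, g, hg, t, ht, ht1, hu⟩ := exists_faithful_representation hA e hF w₀ hw₀
  obtain ⟨ev, w', f, h⟩ := exists_rational_assignment hA e w₀ hw₀ g hg t ht ht1 S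
  refine ⟨w', fun s hs s' hs' => ?_⟩
  rw [← hws s hs, ← hws s' hs', ← e.injective.eq_iff, ← ratCone.injective.eq_iff]
  constructor
  -- Equal values give a symbolic quotient of value 1, hence equal symbols and equal evaluations.
  -- The converse holds because strict inequalities are preserved.
  · intro heq
    rw [← (h s hs).1, ← (h s' hs').1] at heq
    rw [← (h s hs).2.1, ← (h s' hs').2.1]
    by_cases h0 : f s' = 0
    · rw [h0, map_zero, map_eq_zero] at heq
      rw [heq, h0]
    · have h1 := hu (f s / f s') (by rw [map_div₀, heq, div_self (by simpa using h0)])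
      rw [(div_eq_one_iff_eq h0).1 h1]
  · intro heq
    by_contra hne
    rcases lt_or_gt_of_ne hne with hlt | hlt
    · exact ((h s hs).2.2 s' hs' hlt).ne heq
    · exact ((h s' hs').2.2 s hs hlt).ne heq.symm

end Transfer

/-! ### Further facts on rational product algebras -/

section Further

variable {A : Type u} [RBL.Structure A] (hA : IsRationalProductAlgebra A)

include hA in
theorem IsRationalProductAlgebra.meet_self (a : A) : opMeet a a = a := by
  simpa using hA.eq_of_standard (s := tMeet (.var 0) (.var 0)) (t := .var 0)
    (fun w => by simp) fun _ => a

include hA in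
theorem IsRationalProductAlgebra.imp_self (a : A) : opImp a a = opOne A := by
  simpa [hA.meet_self] using hA.meet_imp a a

include hA in
theorem IsRationalProductAlgebra.meet_eq_of_imp {a b : A} (h : opImp a b = opOne A) :
    opMeet a b = a := by
  rw [← hA.mul_imp_self, h, hA.mul_comm, hA.one_mul]

include hA in
theorem IsRationalProductAlgebra.iff_eq_one {a b : A} :
    opMeet (opImp a b) (opImp b a) = opOne A ↔ a = b := by
  constructor
  · intro h
    have h1 : opImp a b = opOne A := by
      rw [← hA.meet_one (opImp a b), ← h, ← hA.meet_assoc, hA.meet_self]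
    have h2 : opImp b a = opOne A := by rwa [h1, hA.meet_comm, hA.meet_one] at h
    rw [← hA.meet_eq_of_imp h1, hA.meet_comm, hA.meet_eq_of_imp h2]
  · rintro rfl
    rw [hA.imp_self, hA.meet_one]

/-- Being a rational product algebra is an equational property. -/
theorem isRationalProductAlgebra_of_eqns {B : Type v} [RBL.Structure B]
    (hA : IsRationalProductAlgebra A)
    (h : ∀ e : Eqn RBL ℕ, Eqn.Valid A e → Eqn.Valid B e) : IsRationalProductAlgebra B := by
  refine ⟨fun e he w => ?_, fun p q => h _ (hA.2.1 p q), fun p q => h _ (hA.2.2.1 p q),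
    h _ hA.2.2.2.1, h _ hA.2.2.2.2⟩
  let _ : BL.Structure B := blIncl.reduct B
  have := h (blIncl.onTerm e.1, blIncl.onTerm e.2) (fun w => hA.eq_of_standard he w) w
  rw [Eqn.Holds, LHom.realize_onTerm, LHom.realize_onTerm] at this
  exact this

end Further

/-- The rational unit interval embeds into the real one. -/
def ratUnitToReal (x : RatUnit) : Set.Icc (0 : ℝ) 1 :=
  ⟨(x.1 : ℝ), by exact_mod_cast x.2.1, by exact_mod_cast x.2.2⟩

/-- The reduct is a subalgebra of the standard product algebra, and equations pass to subalgebras;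
the bookkeeping axioms hold by computation. -/
theorem isRationalProductAlgebra_ratUnit : IsRationalProductAlgebra RatUnit := by
  refine ⟨fun e he w => ?_, fun p q w => rfl, fun p q w => rfl, fun w => rfl, fun w => rfl⟩
  let _ : BL.Structure RatUnit := blIncl.reduct RatUnit
  let f : RatUnit →[BL] Set.Icc (0 : ℝ) 1 :=
    { toFun := ratUnitToReal
      map_fun' := by
        intro n F x
        have hmono : Monotone ratUnitToReal := fun a b h => by
          have : (a.1 : ℝ) ≤ b.1 := by exact_mod_cast h
          exact this
        change BLFunc Empty n at F
        cases F with
        | zero => exact Subtype.ext Rat.cast_zero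
        | one => exact Subtype.ext Rat.cast_one
        | const c => exact c.elim
        | meet => exact hmono.map_min
        | join => exact hmono.map_max
        | mul => exact Subtype.ext (Rat.cast_mul _ _)
        | imp =>
          refine Subtype.ext ?_
          show (((if (x 0).1 ≤ (x 1).1 then 1 else (x 1).1 / (x 0).1 : ℚ)) : ℝ) =
            if ((x 0).1 : ℝ) ≤ (x 1).1 then 1 else ((x 1).1 : ℝ) / (x 0).1
          by_cases h : (x 0).1 ≤ (x 1).1
          · have h' : ((x 0).1 : ℝ) ≤ (x 1).1 := by exact_mod_cast h
            rw [if_pos h, if_pos h', Rat.cast_one]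
          · have h' : ¬ ((x 0).1 : ℝ) ≤ (x 1).1 := by exact_mod_cast h
            rw [if_neg h, if_neg h', Rat.cast_div]
      map_rel' := fun R => Empty.elim R }
  have hinj : Function.Injective f := fun a b h => Subtype.ext (by
    have : (a.1 : ℝ) = b.1 := congrArg Subtype.val h
    exact_mod_cast this)
  have h := he (f ∘ w)
  rw [Eqn.Holds, HomClass.realize_term, HomClass.realize_term] at h
  exact hinj h

theorem ratUnit_imp_eq_one {a b : RatUnit} : opImp a b = opOne RatUnit ↔ a ≤ b :=
  prodImp_eq_one

/-! ### Lifting algebras to higher universes -/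

/-- The classes range over algebras in `Type u`, whereas the rational unit interval and the
Lindenbaum algebras live in `Type`. -/
instance uliftStructure (A : Type) [RBL.Structure A] : RBL.Structure (ULift.{u} A) :=
  Equiv.ulift.symm.inducedStructure

theorem realize_ulift {A : Type} [RBL.Structure A] {α : Type} (t : RBL.Term α)
    (w : α → ULift.{u} A) : (t.realize w).down = t.realize fun x => (w x).down := by
  induction t with
  | var x => rfl
  | func f ts ih => exact congrArg (Structure.funMap f) (funext ih)

theorem Eqn.holds_ulift {A : Type} [RBL.Structure A] {α : Type} (e : Eqn RBL α)
    (w : α → ULift.{u} A) : Eqn.Holds w e ↔ Eqn.Holds (fun x => (w x).down) e := by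
  rw [Eqn.Holds, Eqn.Holds, ← realize_ulift, ← realize_ulift]
  exact ULift.ext_iff

theorem IsRationalProductAlgebra.ulift {A : Type} [RBL.Structure A]
    (hA : IsRationalProductAlgebra A) : IsRationalProductAlgebra (ULift.{u} A) :=
  isRationalProductAlgebra_of_eqns hA fun e he w => (Eqn.holds_ulift e w).2 (he _)

/-! ### Theories from algebras and from logics -/

theorem isTheory_realize_eq_one {A : Type u} [RBL.Structure A] (hA : IsRationalProductAlgebra A)
    (w : ℕ → A) : IsTheory {ψ : RBL.Term ℕ | ψ.realize w = opOne A} where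
  taut t ht σ := by
    simp only [Set.mem_ofPred_eq, Term.realize_subst]
    simpa using hA.eq_of_standard (t := tOne) ht _
  mul_const p q := by
    simp only [Set.mem_ofPred_eq, realize_tIff]
    exact hA.iff_eq_one.2 (hA.2.1 p q w)
  imp_const p q := by
    simp only [Set.mem_ofPred_eq, realize_tIff]
    exact hA.iff_eq_one.2 (hA.2.2.1 p q w)
  zero_const := by
    simp only [Set.mem_ofPred_eq, realize_tIff]
    exact hA.iff_eq_one.2 (hA.2.2.2.1 w)
  one_const := by
    simp only [Set.mem_ofPred_eq, realize_tIff]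
    exact hA.iff_eq_one.2 (hA.2.2.2.2 w)
  mp s t hs ht := by
    simp only [Set.mem_ofPred_eq, realize_tImp] at hs ht ⊢
    rwa [hs, hA.one_imp] at ht

theorem PropLogic.mono {L : FirstOrder.Language.{0, 0}} (S : PropLogic L) {Γ Γ' : Set (L.Term ℕ)}
    {φ : L.Term ℕ} (hΓ : Γ ⊆ Γ') (h : S.Ent Γ φ) : S.Ent Γ' φ :=
  S.cut _ _ _ (fun _ hψ => S.refl _ _ (hΓ hψ)) h

theorem holds_tOne_iff {A : Type u} [RBL.Structure A] (w : ℕ → A) (ψ : RBL.Term ℕ) :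
    Eqn.Holds w (ψ, tOne) ↔ ψ.realize w = opOne A := by
  rw [Eqn.Holds, realize_tOne]

theorem rationalProductLogic_iff {Γ : Set (RBL.Term ℕ)} {φ : RBL.Term ℕ} :
    rationalProductLogic.{u}.Ent Γ φ ↔ ∃ Δ : Set (RBL.Term ℕ), Δ.Finite ∧ Δ ⊆ Γ ∧
      ∀ (A : Type u) [RBL.Structure A], IsRationalProductAlgebra A → ∀ w : ℕ → A,
        (∀ δ ∈ Δ, δ.realize w = opOne A) → φ.realize w = opOne A := by
  simp only [rationalProductLogic, EqConseq, Set.forall_mem_image, holds_tOne_iff]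

theorem rationalProductLogic_empty_iff {φ : RBL.Term ℕ} :
    rationalProductLogic.{u}.Ent ∅ φ ↔
      ∀ (A : Type u) [RBL.Structure A], IsRationalProductAlgebra A → ∀ w : ℕ → A,
        φ.realize w = opOne A := by
  rw [rationalProductLogic_iff]
  constructor
  · rintro ⟨Δ, -, hΔ, h⟩ A _ hA w
    exact h A hA w fun δ hδ => (hΔ hδ).elim
  · exact fun h => ⟨∅, Set.finite_empty, subset_rfl, fun A _ hA w _ => h A hA w⟩

theorem isTheory_entails {S : PropLogic RBL} (hS : IsExtension rationalProductLogic.{u} S)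
    (Γ : Set (RBL.Term ℕ)) : IsTheory {ψ | S.Ent Γ ψ} := by
  have key : ∀ ψ, (∀ (A : Type u) [RBL.Structure A], IsRationalProductAlgebra A → ∀ w : ℕ → A,
      ψ.realize w = opOne A) → S.Ent Γ ψ := fun ψ h =>
    S.mono (Set.empty_subset _) (hS _ _ (rationalProductLogic_empty_iff.2 h))
  refine ⟨fun t ht σ => key _ fun A _ hA w => (isTheory_realize_eq_one hA w).taut t ht σ,
    fun p q => key _ fun A _ hA w => (isTheory_realize_eq_one hA w).mul_const p q,
    fun p q => key _ fun A _ hA w => (isTheory_realize_eq_one hA w).imp_const p q,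
    key _ fun A _ hA w => (isTheory_realize_eq_one hA w).zero_const,
    key _ fun A _ hA w => (isTheory_realize_eq_one hA w).one_const, fun s t hs ht => ?_⟩
  refine S.cut Γ {s, tImp s t} t ?_ (hS _ _ (rationalProductLogic_iff.2
    ⟨_, Set.toFinite _, subset_rfl, fun A _ hA w h => ?_⟩))
  · rintro ψ (rfl | rfl)
    · exact hs
    · exact ht
  · exact (isTheory_realize_eq_one hA w).mp _ _ (h s (by simp)) (h (tImp s t) (by simp))

/-! ### Lindenbaum algebras of linear theories -/

theorem subst_var_eq (t : RBL.Term ℕ) : t.subst Term.var = t := by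
  induction t with
  | var x => rfl
  | func f ts ih => exact congrArg _ (funext ih)

namespace IsTheory

variable {T : Set (RBL.Term ℕ)} (hT : IsTheory T)

theorem realize_cls_var (t : RBL.Term ℕ) : t.realize (fun n => hT.cls (.var n)) = hT.cls t := by
  rw [realize_cls, subst_var_eq]

theorem opImp_cls (s t : RBL.Term ℕ) : opImp (hT.cls s) (hT.cls t) = hT.cls (tImp s t) := by
  rw [← hT.realize_cls_var (tImp s t), realize_tImp, realize_cls_var, realize_cls_var]

theorem isChainAlg (hlin : ∀ s t, tImp s t ∈ T ∨ tImp t s ∈ T) : IsChainAlg hT.Lindenbaum := by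
  intro a b
  obtain ⟨s, rfl⟩ : ∃ s, hT.cls s = a := Quotient.exists_rep a
  obtain ⟨t, rfl⟩ : ∃ t, hT.cls t = b := Quotient.exists_rep b
  rcases hlin s t with h | h
  · exact Or.inl (hT.isRationalProductAlgebra.meet_eq_of_imp (by
      rw [opImp_cls, cls_eq_one]; exact h))
  · exact Or.inr (hT.isRationalProductAlgebra.meet_eq_of_imp (by
      rw [opImp_cls, cls_eq_one]; exact h))

end IsTheory

/-- Rational product algebras satisfy the equations `φ ≈ 1` of the rational unit interval. -/
theorem realize_eq_one_of_ratUnit {φ : RBL.Term ℕ}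
    (h : ∀ w : ℕ → RatUnit, φ.realize w = opOne RatUnit) {A : Type u} [RBL.Structure A]
    (hA : IsRationalProductAlgebra A) (w : ℕ → A) : φ.realize w = opOne A := by
  by_contra hφ
  obtain ⟨T, hT, -, hφT, hlin, -⟩ := (isTheory_realize_eq_one hA w).exists_prime (φ := φ) hφ
  obtain ⟨w', hw'⟩ := exists_ratUnit_ne_one hT.isRationalProductAlgebra (hT.isChainAlg hlin)
    (fun n => hT.cls (.var n)) φ (by rwa [hT.realize_cls_var, Ne, hT.cls_eq_one])
  exact hw' (h w')

/-! ### The chain axioms -/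

section ChainAxioms

variable {A : Type u} [RBL.Structure A] {Q : Set RatUnit}

theorem satisfiesChainAxioms_iff : SatisfiesChainAxioms Q A ↔ IsChainAlg A ∧
    (∀ q ∈ Q, opConst A q ≠ opOne A) ∧
    ∀ p n, IrrationalRoot p n → ∀ a : A, opConst A p ≠ opPow a n := by
  simp only [SatisfiesChainAxioms, Eqn.Holds, realize_tMeet, Term.realize_var, realize_tConst,
    realize_tOne, realize_tPow]
  refine and_congr ⟨fun h a b => h (asg a b b b), fun h w => h _ _⟩ (and_congr ?_ ?_)
  · exact ⟨fun h q hq => h q hq fun _ => opOne A, fun h q hq _ => h q hq⟩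
  · exact ⟨fun h p n hp a => h p n hp fun _ => a, fun h p n hp w => h p n hp _⟩

/-- If c_q = 1 for some q < 1, then all powers of c_q are 1 and some power of q lies below q₀, so
c_{q₀} = 1. Hence a single point of `Q` suffices. -/
theorem isFaithful_of_const_ne_one (hA : IsRationalProductAlgebra A) {q₀ : RatUnit}
    (hq₀ : 0 < q₀) (h : opConst A q₀ ≠ opOne A)
    (hroot : ∀ p n, IrrationalRoot p n → ∀ a : A, opConst A p ≠ opPow a n) : IsFaithful A := by
  refine ⟨fun q hq hq1 => h ?_, hroot⟩
  have hlt : q.1 < 1 := lt_of_le_of_ne q.2.2 fun h1 => hq (Subtype.ext h1)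
  obtain ⟨k, hk⟩ := exists_pow_lt_of_lt_one (show 0 < q₀.1 from hq₀) hlt
  have hpow : opConst A (q ^ k) = opOne A := by
    clear hk
    induction k with
    | zero => rw [pow_zero, hA.const_one]
    | succ k ih => rw [pow_succ, ← hA.const_mul, ih, hq1, hA.one_mul]
  have hle : q ^ k ≤ q₀ := show (q ^ k).1 ≤ q₀.1 from hk.le
  have h1 := hA.const_imp (q ^ k) q₀
  rwa [prodImp_eq_one.2 hle, hpow, hA.one_imp, hA.const_one] at h1

theorem SatisfiesChainAxioms.isFaithful (hA : IsRationalProductAlgebra A) (hQ : Q.Nonempty)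
    (hQ' : Q ⊆ Set.Ioo 0 1) (h : SatisfiesChainAxioms Q A) : IsFaithful A := by
  obtain ⟨q, hq⟩ := hQ
  rw [satisfiesChainAxioms_iff] at h
  exact isFaithful_of_const_ne_one hA (hQ' hq).1 (h.2.1 q hq) h.2.2

theorem ratUnit_const_ne_opPow {p : RatUnit} {n : ℕ} (hp : IrrationalRoot p n) (x : RatUnit) :
    opConst RatUnit p ≠ opPow x n := by
  intro h
  have hpow : ∀ n : ℕ, (opPow x n).1 = x.1 ^ n := fun n => by
    induction n with
    | zero => exact (pow_zero _).symm
    | succ n ih => rw [pow_succ, ← ih]; rfl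
  have h1 : p.1 = x.1 ^ n := by rw [← hpow, ← h]; rfl
  refine hp.2 ⟨x.1, ?_⟩
  have hx : (0 : ℝ) ≤ x.1 := by exact_mod_cast x.2.1
  rw [h1, Rat.cast_pow, one_div, Real.pow_rpow_inv_natCast hx (by have := hp.1; omega)]

theorem satisfiesChainAxioms_ratUnit (hQ' : Q ⊆ Set.Ioo 0 1) : SatisfiesChainAxioms Q RatUnit := by
  refine satisfiesChainAxioms_iff.2 ⟨fun a b => ?_, fun q hq h => ?_,
    fun p n hp x => ratUnit_const_ne_opPow hp x⟩
  · rcases le_total a b with h | h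
    · exact Or.inl (min_eq_left h)
    · exact Or.inr (min_eq_left h)
  · exact (hQ' hq).2.ne h

end ChainAxioms

/-! ### The logic of the rational unit interval -/

/-- The finitary consequence relation of the rational unit interval. -/
def ratLogic : PropLogic RBL where
  Ent Γ φ := ∃ Δ : Set (RBL.Term ℕ), Δ.Finite ∧ Δ ⊆ Γ ∧
    ∀ w : ℕ → RatUnit, (∀ δ ∈ Δ, δ.realize w = opOne RatUnit) → φ.realize w = opOne RatUnit
  refl Γ φ h := ⟨{φ}, Set.finite_singleton φ, by simpa using h, fun w hw => hw φ rfl⟩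
  cut := by
    rintro Γ Δ φ h ⟨Δ', hfin, hsub, hΔ'⟩
    choose! f hf1 hf2 hf3 using h
    refine ⟨⋃ ψ ∈ Δ', f ψ, hfin.biUnion fun ψ hψ => hf1 ψ (hsub hψ),
      Set.iUnion₂_subset fun ψ hψ => hf2 ψ (hsub hψ), fun w hw => hΔ' w fun ψ hψ => ?_⟩
    exact hf3 ψ (hsub hψ) w fun χ hχ => hw χ (Set.mem_biUnion hψ hχ)
  substInvariant := by
    rintro σ Γ φ ⟨Δ, hfin, hsub, hΔ⟩
    refine ⟨_, hfin.image _, Set.image_mono hsub, fun w hw => ?_⟩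
    rw [Term.realize_subst]
    refine hΔ _ fun δ hδ => ?_
    rw [← Term.realize_subst]
    exact hw _ ⟨δ, hδ, rfl⟩
  finitary := by
    rintro Γ φ ⟨Δ, hfin, hsub, hΔ⟩
    exact ⟨Δ, hfin, hsub, Δ, hfin, subset_rfl, hΔ⟩

theorem ratLogic_of_finite {Δ : Set (RBL.Term ℕ)} (hΔ : Δ.Finite) {φ : RBL.Term ℕ} :
    ratLogic.Ent Δ φ ↔ ∀ w : ℕ → RatUnit, (∀ δ ∈ Δ, δ.realize w = opOne RatUnit) →
      φ.realize w = opOne RatUnit :=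
  ⟨fun ⟨_, _, hsub, h⟩ w hw => h w fun δ hδ => hw δ (hsub hδ), fun h => ⟨Δ, hΔ, subset_rfl, h⟩⟩

theorem isExtension_ratLogic : IsExtension rationalProductLogic.{u} ratLogic := by
  intro Γ φ h
  obtain ⟨Δ, hfin, hsub, hΔ⟩ := rationalProductLogic_iff.1 h
  refine ⟨Δ, hfin, hsub, fun w hw => ?_⟩
  have key : ∀ ψ : RBL.Term ℕ, ψ.realize (fun n => (ULift.up.{u} (w n))) =
      opOne (ULift.{u} RatUnit) ↔ ψ.realize w = opOne RatUnit := fun ψ => by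
    rw [← holds_tOne_iff, ← holds_tOne_iff, Eqn.holds_ulift]
  exact (key φ).1 (hΔ _ isRationalProductAlgebra_ratUnit.ulift _ fun δ hδ => (key δ).2 (hw δ hδ))

/-- An assignment in the rational unit interval is imitated by the substitution of constants: each
substituted formula is closed and has the original value everywhere. An admissible rule therefore
preserves value 1 under every assignment. -/
theorem isStructuralCompletion_ratLogic :
    IsStructuralCompletion rationalProductLogic.{u} ratLogic := by
  refine ⟨isExtension_ratLogic, fun r hr => ?_, fun φ => ⟨fun h => ?_, isExtension_ratLogic _ _⟩⟩
  · refine (ratLogic_of_finite r.prem.finite_toSet).2 fun w hw => ?_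
    have key : ∀ (ψ : RBL.Term ℕ) (w' : ℕ → RatUnit),
        (ψ.subst fun n => tConst (w n)).realize w' = ψ.realize w := fun ψ w' => by
      rw [Term.realize_subst]
      congr 1
    have h1 := hr (fun n => tConst (w n)) fun γ hγ =>
      (ratLogic_of_finite Set.finite_empty).2 fun w' _ => by rw [key]; exact hw γ hγ
    have h2 := (ratLogic_of_finite Set.finite_empty).1 h1 w fun δ hδ => hδ.elim
    rwa [key] at h2
  · exact rationalProductLogic_empty_iff.2 fun A _ hA w => realize_eq_one_of_ratUnit
      (fun w' => (ratLogic_of_finite Set.finite_empty).1 h w' fun δ hδ => hδ.elim) hA w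

/-- Structurally complete logics with the same theorems coincide. -/
theorem ent_of_isStructurallyComplete {L : FirstOrder.Language.{0, 0}} {S S' : PropLogic L}
    (hS' : IsStructurallyComplete S') (h : ∀ φ, S.Ent ∅ φ ↔ S'.Ent ∅ φ) : IsExtension S S' := by
  intro Γ φ hΓ
  obtain ⟨Δ, hfin, hsub, hΔ⟩ := S.finitary Γ φ hΓ
  have h1 := hS' ⟨hfin.toFinset, φ⟩ fun σ hσ => by
    rw [← h]
    refine S.cut _ _ _ ?_ (S.substInvariant σ Δ φ hΔ)
    rintro _ ⟨ψ, hψ, rfl⟩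
    exact (h _).2 (hσ ψ (by simpa using hψ))
  refine S'.mono hsub ?_
  simpa [Rule.Derivable] using h1

theorem IsStructuralCompletion.unique {L : FirstOrder.Language.{0, 0}} {S S₁ S₂ : PropLogic L}
    (h₁ : IsStructuralCompletion S S₁) (h₂ : IsStructuralCompletion S S₂) : S₁ = S₂ := by
  refine PropLogic.ext (funext₂ fun Γ φ => propext ⟨?_, ?_⟩)
  · exact ent_of_isStructurallyComplete h₂.2.1 (fun ψ => (h₁.2.2 ψ).trans (h₂.2.2 ψ).symm) Γ φ
  · exact ent_of_isStructurallyComplete h₁.2.1 (fun ψ => (h₂.2.2 ψ).trans (h₁.2.2 ψ).symm) Γ φ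

/-! ### The equivalent algebraic semantics -/

theorem quasivarietyGen_isRationalProductAlgebra {A : Type u} [RBL.Structure A]
    (hA : quasivarietyGen.{u} (L := RBL) RatUnit A) : IsRationalProductAlgebra A :=
  isRationalProductAlgebra_of_eqns isRationalProductAlgebra_ratUnit fun e he w =>
    hA ⟨∅, e⟩ (fun w _ => he w) w (by simp)

/-- An assignment lifts to a substitution, under which the premises of a quasiequation become
finitely many implications entailed by `Γ`. Validity in the rational unit interval says that these
entail the two implications for the conclusion. -/
theorem quasivarietyGen_lindenbaum (Γ : Set (RBL.Term ℕ)) :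
    quasivarietyGen.{u} (L := RBL) RatUnit
      (ULift.{u} (isTheory_entails isExtension_ratLogic.{0} Γ).Lindenbaum) := by
  have hT := isTheory_entails isExtension_ratLogic.{0} Γ
  intro q hq w
  simp only [Eqn.holds_ulift]
  obtain ⟨σ, hσ⟩ := hT.exists_lift fun x => (w x).down
  rw [hσ]
  simp only [Eqn.Holds, hT.realize_cls, hT.cls_eq_cls]
  intro hprem
  let Δ : Set (RBL.Term ℕ) := ⋃ e ∈ q.prem,
    {tImp (e.1.subst σ) (e.2.subst σ), tImp (e.2.subst σ) (e.1.subst σ)}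
  have hfin : Δ.Finite := q.prem.finite_toSet.biUnion fun e _ => Set.toFinite _
  have hΔ : ∀ δ ∈ Δ, ratLogic.Ent Γ δ := by
    intro δ hδ
    obtain ⟨e, he, hδ⟩ := Set.mem_iUnion₂.1 hδ
    rcases hδ with rfl | rfl
    · exact (hprem e he).1
    · exact (hprem e he).2
  have heq : ∀ w' : ℕ → RatUnit, (∀ δ ∈ Δ, δ.realize w' = opOne RatUnit) →
      (q.concl.1.subst σ).realize w' = (q.concl.2.subst σ).realize w' := by
    intro w' hw'
    rw [Term.realize_subst, Term.realize_subst]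
    refine hq _ fun e he => ?_
    rw [Eqn.Holds, ← Term.realize_subst, ← Term.realize_subst]
    have h1 := hw' (tImp (e.1.subst σ) (e.2.subst σ)) (Set.mem_biUnion he (by simp))
    have h2 := hw' (tImp (e.2.subst σ) (e.1.subst σ)) (Set.mem_biUnion he (by simp))
    rw [realize_tImp, ratUnit_imp_eq_one] at h1 h2
    exact le_antisymm h1 h2
  refine ⟨ratLogic.cut _ _ _ hΔ ((ratLogic_of_finite hfin).2 fun w' hw' => ?_),
    ratLogic.cut _ _ _ hΔ ((ratLogic_of_finite hfin).2 fun w' hw' => ?_)⟩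
  · rw [realize_tImp, ratUnit_imp_eq_one, heq w' hw']
  · rw [realize_tImp, ratUnit_imp_eq_one, heq w' hw']

/-- A finite entailment is a quasiequation of the rational unit interval. Conversely, the canonical
assignment in the Lindenbaum algebra of `Γ` sends exactly the consequences of `Γ` to 1, for infinite
`Γ` as well. -/
theorem ratLogic_iff_quasivariety {Γ : Set (RBL.Term ℕ)} {φ : RBL.Term ℕ} :
    ratLogic.Ent Γ φ ↔ ∀ (A : Type u) [RBL.Structure A],
      quasivarietyGen.{u} (L := RBL) RatUnit A → ∀ w : ℕ → A,
        (∀ γ ∈ Γ, γ.realize w = opOne A) → φ.realize w = opOne A := by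
  classical
  constructor
  · rintro ⟨Δ, hfin, hsub, hΔ⟩ A _ hA w hw
    rw [← holds_tOne_iff]
    refine hA ⟨hfin.toFinset.image fun δ => (δ, tOne), (φ, tOne)⟩ (fun w' hw' => ?_) w ?_
    · simp only [Finset.forall_mem_image, holds_tOne_iff, Set.Finite.mem_toFinset] at hw' ⊢
      exact hΔ w' hw'
    · simp only [Finset.forall_mem_image, holds_tOne_iff, Set.Finite.mem_toFinset]
      exact fun δ hδ => hw δ (hsub hδ)
  · intro h
    have hT := isTheory_entails isExtension_ratLogic.{0} Γ
    have key : ∀ ψ : RBL.Term ℕ, ψ.realize (fun n => ULift.up.{u} (hT.cls (.var n))) =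
        opOne (ULift.{u} hT.Lindenbaum) ↔ ratLogic.Ent Γ ψ := fun ψ => by
      rw [← holds_tOne_iff, Eqn.holds_ulift, holds_tOne_iff, hT.realize_cls_var, hT.cls_eq_one]
      rfl
    exact (key φ).1 (h _ (quasivarietyGen_lindenbaum Γ) _ fun γ hγ =>
      (key γ).2 (ratLogic.refl _ _ hγ))

/-! ### Designated elements -/

section Instances

variable {L : FirstOrder.Language.{0, 0}} {A : Type u} [L.Structure A]

/-- The elements of an algebra at which the equations `τ` hold. -/
def designated (τ : Set (Eqn L Unit)) (A : Type u) [L.Structure A] : Set A :=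
  {a | ∀ e ∈ τ, e.1.realize (fun _ => a) = e.2.realize fun _ => a}

theorem holds_instEqns_iff (τ : Set (Eqn L Unit)) (w : ℕ → A) (φ : L.Term ℕ) :
    (∀ e ∈ instEqns τ φ, Eqn.Holds w e) ↔ φ.realize w ∈ designated τ A := by
  simp only [instEqns, Set.forall_mem_image, Eqn.Holds, Term.realize_subst]
  rfl

theorem holds_iUnion_instEqns_iff (τ : Set (Eqn L Unit)) (w : ℕ → A) (Γ : Set (L.Term ℕ)) :
    (∀ e ∈ ⋃ γ ∈ Γ, instEqns τ γ, Eqn.Holds w e) ↔ ∀ γ ∈ Γ, γ.realize w ∈ designated τ A := by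
  simp only [← holds_instEqns_iff, Set.mem_iUnion₂]
  exact ⟨fun h γ hγ e he => h e ⟨γ, hγ, he⟩, fun h e ⟨γ, hγ, he⟩ => h γ hγ e he⟩

theorem forall_eqConseq_instEqns_iff (K : AlgClass.{u} L) (τ : Set (Eqn L Unit))
    (Γ : Set (L.Term ℕ)) (φ : L.Term ℕ) :
    (∀ e ∈ instEqns τ φ, EqConseq K (⋃ γ ∈ Γ, instEqns τ γ) e) ↔
      ∀ (A : Type u) [L.Structure A], K A → ∀ w : ℕ → A,
        (∀ γ ∈ Γ, γ.realize w ∈ designated τ A) → φ.realize w ∈ designated τ A := by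
  refine ⟨fun h A _ hA w hw => ?_, fun h e he A _ hA w hw => ?_⟩
  · exact (holds_instEqns_iff τ w φ).1 fun e he =>
      h e he A hA w ((holds_iUnion_instEqns_iff τ w Γ).2 hw)
  · exact (holds_instEqns_iff τ w φ).2
      (h A hA w ((holds_iUnion_instEqns_iff τ w Γ).1 hw)) e he

end Instances

theorem designated_tOne (A : Type u) [RBL.Structure A] :
    designated {((.var () : RBL.Term Unit), tOne)} A = {opOne A} := by
  ext a
  simp [designated]

/-- The translations are x ≈ 1 and x ↔ y. -/
theorem isAlgebraizedBy_ratLogic :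
    IsAlgebraizedBy ratLogic (quasivarietyGen.{u} (L := RBL) RatUnit) := by
  refine ⟨⟨{q | q.Valid RatUnit}, fun _ _ => Iff.rfl⟩, {(.var (), tOne)},
    {tIff (.var 0) (.var 1)}, Set.finite_singleton _, Set.finite_singleton _, fun Γ φ => ?_, ?_, ?_⟩
  · rw [forall_eqConseq_instEqns_iff, ratLogic_iff_quasivariety.{u}]
    simp only [designated_tOne, Set.mem_singleton_iff]
  · intro e he A _ hA w hw
    refine (holds_iUnion_instEqns_iff _ w _).2 ?_ e he
    simp only [instFmls, Set.image_singleton, Set.mem_singleton_iff, forall_eq, designated_tOne,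
      subst_tIff, realize_tIff, (quasivarietyGen_isRationalProductAlgebra hA).iff_eq_one]
    exact hw _ rfl
  · intro A _ hA w hw
    have h := (holds_iUnion_instEqns_iff _ w _).1 hw
    simp only [instFmls, Set.image_singleton, Set.mem_singleton_iff, forall_eq, designated_tOne,
      subst_tIff, realize_tIff, (quasivarietyGen_isRationalProductAlgebra hA).iff_eq_one] at h
    exact h

theorem realize_subst_pair {A : Type u} [RBL.Structure A] (δ : RBL.Term (Fin 2))
    (s t : RBL.Term ℕ) (w : ℕ → A) :
    (δ.subst ![s, t]).realize w = δ.realize ![s.realize w, t.realize w] := by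
  rw [Term.realize_subst]
  congr 1
  funext i
  fin_cases i <;> rfl

/-- An extension of rational product logic is determined by its equivalent algebraic semantics. -/
theorem eq_ratLogic_of_isAlgebraizedBy {S : PropLogic RBL}
    (hS : IsExtension rationalProductLogic.{u} S)
    (h : IsAlgebraizedBy S (quasivarietyGen.{u} (L := RBL) RatUnit)) : S = ratLogic := by
  obtain ⟨-, τ, Δ, -, -, hent, h₁, h₂⟩ := h
  have hent' := fun Γ φ => (hent Γ φ).trans (forall_eqConseq_instEqns_iff _ τ Γ φ)
  have hΔ : ∀ (A : Type u) [RBL.Structure A], quasivarietyGen.{u} (L := RBL) RatUnit A →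
      ∀ a b : A, (∀ δ ∈ Δ, δ.realize ![a, b] ∈ designated τ A) ↔ a = b := by
    intro A _ hA a b
    have key : (∀ γ ∈ instFmls Δ (.var 0) (.var 1),
        γ.realize (asg a b b b) ∈ designated τ A) ↔
        ∀ δ ∈ Δ, δ.realize ![a, b] ∈ designated τ A := by
      simp only [instFmls, Set.forall_mem_image, realize_subst_pair]
      rfl
    rw [← key, ← holds_iUnion_instEqns_iff]
    refine ⟨fun h => h₂ A hA _ h, fun hab e he => h₁ e he A hA _ ?_⟩
    rintro _ rfl
    exact hab
  -- The given translations τ and Δ are arbitrary, but for an extension of rational product logic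
  -- they must designate exactly the element 1; the logic is then determined by the quasivariety.
  have hdes : ∀ (A : Type u) [RBL.Structure A], quasivarietyGen.{u} (L := RBL) RatUnit A →
      designated τ A = {opOne A} := by
    intro A _ hA
    ext a
    rw [Set.mem_singleton_iff]
    constructor
    · intro ha
      rw [← hΔ A hA]
      intro δ hδ
      have hthm : S.Ent ∅ (δ.subst ![tOne, tOne]) := by
        rw [hent']
        intro B _ hB w _
        rw [realize_subst_pair]
        exact (hΔ B hB _ _).2 rfl δ hδ
      -- δ(1,1) is a theorem, and in rational product logic x together with δ(1,1) yields δ(x,1),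
      -- since x is forced to be 1. A designated `a` thus makes all δ(a,1) designated, that is, a =
      -- 1.
      have hx : S.Ent {.var 0} (δ.subst ![.var 0, tOne]) := by
        refine S.cut _ {.var 0, δ.subst ![tOne, tOne]} _ ?_ (hS _ _ (rationalProductLogic_iff.2
          ⟨_, Set.toFinite _, subset_rfl, fun B _ hB w hw => ?_⟩))
        · rintro ψ (rfl | rfl)
          · exact S.refl _ _ rfl
          · exact S.mono (Set.empty_subset _) hthm
        · have hw0 := hw (.var 0) (by simp)
          have hw1 := hw (δ.subst ![tOne, tOne]) (by simp)
          rw [realize_subst_pair] at hw1 ⊢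
          rw [realize_tOne] at hw1 ⊢
          rwa [hw0]
      have := (hent' _ _).1 hx A hA (fun _ => a) (by
        rintro γ rfl
        exact ha)
      rw [realize_subst_pair, realize_tOne] at this
      exact this
    · rintro rfl
      have h1 : S.Ent ∅ tOne :=
        hS _ _ (rationalProductLogic_empty_iff.2 fun B _ _ w => realize_tOne w)
      have := (hent' _ _).1 h1 A hA (fun _ => opOne A) (fun γ hγ => hγ.elim)
      rwa [realize_tOne] at this
  refine PropLogic.ext (funext₂ fun Γ φ => propext ?_)
  rw [hent', ratLogic_iff_quasivariety.{u}]
  refine forall_congr' fun A => forall_congr' fun _ => forall_congr' fun hA => ?_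
  rw [hdes A hA]
  rfl

/-! ### The base for the admissible rules -/

/-- In a chain a join equals 1 only if one of its members does, and neither a constant c_q with q <
1 nor c_p ↔ xⁿ with an irrational root ever takes the value 1. -/
theorem derivable_baseRules_ratLogic {Q : Set RatUnit} (hQ : Q ⊆ Set.Ioo 0 1) :
    ∀ r ∈ baseRules Q, r.Derivable ratLogic := by
  have hjoin : ∀ a b : RatUnit, opJoin a b = opOne RatUnit → a ≠ opOne RatUnit →
      b = opOne RatUnit := fun a b h ha => by
    have h1 : max a b = opOne RatUnit := h
    rcases max_choice a b with h2 | h2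
    · exact absurd (h2.symm.trans h1) ha
    · exact h2.symm.trans h1
  rintro r (⟨q, hq, rfl⟩ | ⟨p, n, hp, rfl⟩)
  · refine (ratLogic_of_finite (Finset.finite_toSet _)).2 fun w hw => ?_
    have h := hw (tJoin (tConst q) (.var 1)) (by simp [constRule])
    rw [realize_tJoin, realize_tConst] at h
    exact hjoin _ _ h (hQ hq).2.ne
  · refine (ratLogic_of_finite (Finset.finite_toSet _)).2 fun w hw => ?_
    have h := hw (tJoin (tIff (tConst p) (tPow (.var 0) n)) (.var 1)) (by simp [rootRule])
    rw [realize_tJoin, realize_tIff, realize_tConst, realize_tPow] at h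
    refine hjoin _ _ h fun h1 => ?_
    rw [isRationalProductAlgebra_ratUnit.iff_eq_one] at h1
    exact ratUnit_const_ne_opPow hp _ h1

/-- If `Γ` does not entail φ in `S`, the rules allow a prime theory above the consequences of `Γ`
that omits φ, the constants c_q and all instances of c_p ↔ xⁿ. Its Lindenbaum algebra is a faithful
chain, so a refutation on finitely many formulas moves to the rational unit interval. -/
theorem isExtension_of_derivable_baseRules {Q : Set RatUnit} (hQ : Q.Nonempty)
    (hQ' : Q ⊆ Set.Ioo 0 1) {S : PropLogic RBL} (hS : IsExtension rationalProductLogic.{u} S)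
    (hr : ∀ r ∈ baseRules Q, r.Derivable S) : IsExtension ratLogic S := by
  classical
  rintro Γ φ ⟨Δ, hfin, hsub, hΔ⟩
  by_contra hφ
  have hrule : ∀ r ∈ baseRules Q, ∀ σ : ℕ → RBL.Term ℕ,
      (∀ γ ∈ r.prem, S.Ent Γ (γ.subst σ)) → S.Ent Γ (r.concl.subst σ) := fun r hrQ σ h =>
    S.cut _ _ _ (by rintro _ ⟨γ, hγ, rfl⟩; exact h γ hγ) (S.substInvariant σ _ _ (hr r hrQ))
  obtain ⟨T, hT, hT₀, hφT, hlin, havoid⟩ := (isTheory_entails hS Γ).exists_prime (φ := φ) hφ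
  have hA := hT.isRationalProductAlgebra
  have hF : IsFaithful hT.Lindenbaum := by
    refine SatisfiesChainAxioms.isFaithful (Q := Q) hA hQ hQ' (satisfiesChainAxioms_iff.2
      ⟨hT.isChainAlg hlin, fun q hq h => ?_, fun p n hp a h => ?_⟩)
    · rw [← realize_tConst (fun n => hT.cls (.var n)), hT.realize_cls_var, hT.cls_eq_one] at h
      refine havoid _ (fun z hz => ?_) h
      simpa [constRule] using hrule _ (Or.inl ⟨q, hq, rfl⟩) (fun _ => z)
        (by simpa [constRule] using hz)
    · obtain ⟨s, rfl⟩ : ∃ s, hT.cls s = a := Quotient.exists_rep a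
      rw [← hT.realize_cls_var s, ← realize_tPow, ← realize_tConst (fun n => hT.cls (.var n)),
        ← hA.iff_eq_one, ← realize_tIff, hT.realize_cls_var, hT.cls_eq_one] at h
      refine havoid _ (fun z hz => ?_) h
      -- The rule has root variable x₀ and side variable x₁, instantiated by `s` and `z`.
      simpa [rootRule] using hrule _ (Or.inr ⟨p, n, hp, rfl⟩) (asg s z z z)
        (by simpa [rootRule] using hz)
  obtain ⟨w', hw'⟩ := exists_ratUnit_assignment hA (hT.isChainAlg hlin) hF
    (fun n => hT.cls (.var n)) (insert tOne (insert φ hfin.toFinset))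
  have key : ∀ ψ ∈ insert φ hfin.toFinset, (ψ ∈ T ↔ ψ.realize w' = opOne RatUnit) := fun ψ hψ => by
    have := hw' ψ (Finset.mem_insert_of_mem hψ) tOne (Finset.mem_insert_self _ _)
    rwa [realize_tOne, realize_tOne, hT.realize_cls_var, hT.cls_eq_one] at this
  refine hφT ((key φ (by simp)).2 (hΔ w' fun δ hδ => (key δ (by simp [hδ])).1 (hT₀ ?_)))
  exact S.refl _ _ (hsub hδ)

theorem isBaseForAdmissibleRules_baseRules {Q : Set RatUnit} (hQ : Q.Nonempty)
    (hQ' : Q ⊆ Set.Ioo 0 1) :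
    IsBaseForAdmissibleRules rationalProductLogic.{u} (baseRules Q) :=
  ⟨ratLogic, isStructuralCompletion_ratLogic,
    ⟨isExtension_ratLogic, derivable_baseRules_ratLogic hQ'⟩,
    fun _ hS hr => isExtension_of_derivable_baseRules hQ hQ' hS hr⟩

/-! ### The universal theory -/

/-- Quantifier-free formulas depend on finitely many equations between terms. -/
theorem exists_finset_of_isQF {n : ℕ} {φ : RBL.BoundedFormula Empty n} (hφ : φ.IsQF) :
    ∃ S : Finset (RBL.Term (Empty ⊕ Fin n)), ∀ {A : Type u} {B : Type v} [RBL.Structure A]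
      [RBL.Structure B] (a : Empty → A) (x : Fin n → A) (b : Empty → B) (y : Fin n → B),
      (∀ s ∈ S, ∀ t ∈ S, (s.realize (Sum.elim a x) = t.realize (Sum.elim a x) ↔
        s.realize (Sum.elim b y) = t.realize (Sum.elim b y))) →
      (φ.Realize a x ↔ φ.Realize b y) := by
  classical
  induction hφ with
  | falsum => exact ⟨∅, fun _ _ _ _ _ => Iff.rfl⟩
  | of_isAtomic h =>
    cases h with
    | equal t₁ t₂ =>
      refine ⟨{t₁, t₂}, fun a x b y h => ?_⟩
      simpa using h t₁ (by simp) t₂ (by simp)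
    | rel R ts => exact Empty.elim R
  | imp _ _ ih₁ ih₂ =>
    obtain ⟨S₁, h₁⟩ := ih₁
    obtain ⟨S₂, h₂⟩ := ih₂
    refine ⟨S₁ ∪ S₂, fun a x b y h => ?_⟩
    rw [BoundedFormula.realize_imp, BoundedFormula.realize_imp,
      h₁ a x b y fun s hs t ht => h s (by simp [hs]) t (by simp [ht]),
      h₂ a x b y fun s hs t ht => h s (by simp [hs]) t (by simp [ht])]

/-- A universal formula that fails in a faithful chain fails in the rational unit interval. -/
theorem exists_not_realize_of_isUniversal {A : Type u} [RBL.Structure A]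
    (hA : IsRationalProductAlgebra A) (hlin : IsChainAlg A) (hF : IsFaithful A) {n : ℕ}
    {φ : RBL.BoundedFormula Empty n} (hφ : φ.IsUniversal) (a : Empty → A) (x : Fin n → A)
    (h : ¬ φ.Realize a x) :
    ∃ (b : Empty → RatUnit) (y : Fin n → RatUnit), ¬ φ.Realize b y := by
  induction hφ with
  | of_isQF hqf =>
    obtain ⟨S, hS⟩ := exists_finset_of_isQF hqf
    obtain ⟨w, hw⟩ := exists_ratUnit_assignment hA hlin hF (Sum.elim a x) S
    refine ⟨w ∘ Sum.inl, w ∘ Sum.inr, fun h' => h ((hS _ _ _ _ ?_).2 h')⟩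
    rwa [Sum.elim_comp_inl_inr]
  | all _ ih =>
    rw [BoundedFormula.realize_all, not_forall] at h
    obtain ⟨c, hc⟩ := h
    obtain ⟨b, y, hy⟩ := ih _ hc
    -- The last coordinate of the counterexample refutes the outermost quantifier; the others
    -- interpret the remaining variables.
    refine ⟨b, Fin.init y, fun h' => hy ?_⟩
    have := BoundedFormula.realize_all.1 h' (y (Fin.last _))
    rwa [Fin.snoc_init_self] at this

theorem isUniversal_alls {L : FirstOrder.Language.{0, 0}} {α : Type} {n : ℕ}
    {φ : L.BoundedFormula α n} (hφ : φ.IsUniversal) : φ.alls.IsUniversal := by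
  induction n with
  | zero => exact hφ
  | succ n ih => exact ih hφ.all

theorem SatisfiesUniversalTheory.realize {A : Type u} [RBL.Structure A]
    (h : SatisfiesUniversalTheory.{u} RatUnit A) {n : ℕ} {φ : RBL.BoundedFormula Empty n}
    (hφ : φ.IsQF) (hB : ∀ y : Fin n → RatUnit, φ.Realize default y) (x : Fin n → A) :
    φ.Realize default x :=
  BoundedFormula.realize_alls.1
    (h φ.alls (isUniversal_alls hφ.isUniversal) (BoundedFormula.realize_alls.2 hB)) x

/-- Each axiom is the universal closure of a quantifier-free formula true in the rational unit
interval. -/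
theorem satisfiesChainAxioms_of_universalTheory {Q : Set RatUnit} (hQ : Q ⊆ Set.Ioo 0 1)
    {A : Type u} [RBL.Structure A] (h : SatisfiesUniversalTheory.{u} RatUnit A) :
    SatisfiesChainAxioms Q A := by
  obtain ⟨hlin, hconst, hroot⟩ := satisfiesChainAxioms_iff.1 (satisfiesChainAxioms_ratUnit hQ)
  have heq : ∀ {n : ℕ} (s t : RBL.Term (Empty ⊕ Fin n)),
      (s.bdEqual t : RBL.BoundedFormula Empty n).IsQF := fun s t =>
    (BoundedFormula.IsAtomic.equal s t).isQF
  refine satisfiesChainAxioms_iff.2 ⟨fun a b => ?_, fun q hq => ?_, fun p n hp a => ?_⟩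
  · let v : Fin 2 → RBL.Term (Empty ⊕ Fin 2) := fun i => .var (.inr i)
    have := h.realize (φ := (tMeet (v 0) (v 1)).bdEqual (v 0) ⊔ (tMeet (v 1) (v 0)).bdEqual (v 1))
      ((heq _ _).sup (heq _ _)) (fun y => by simpa [v] using hlin (y 0) (y 1)) ![a, b]
    simpa [v] using this
  · have := h.realize (n := 0) (φ := ∼((tConst q).bdEqual tOne)) (heq _ _).not
      (fun y => by simpa using hconst q hq) default
    simpa using this
  · have := h.realize (n := 1) (φ := ∼((tConst p).bdEqual (tPow (.var (.inr 0)) n))) (heq _ _).not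
      (fun y => by simpa using hroot p n hp (y 0)) ![a]
    simpa using this

end RPL

/-! ### Assembly of the three claims -/

theorem theorem6p1 :
    -- the structural completion `S` of rational product logic exists and is unique
    (∃ S : RPL.PropLogic RPL.RBL,
      RPL.IsStructuralCompletion RPL.rationalProductLogic.{u} S ∧
      (∀ S' : RPL.PropLogic RPL.RBL,
        RPL.IsStructuralCompletion RPL.rationalProductLogic.{u} S' → S' = S) ∧
      -- `S` is the unique extension with equivalent algebraic semantics `Q(Q_Π)`
      RPL.IsExtension RPL.rationalProductLogic.{u} S ∧
      RPL.IsAlgebraizedBy S (RPL.quasivarietyGen.{u} (L := RPL.RBL) RPL.RatUnit) ∧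
      (∀ S' : RPL.PropLogic RPL.RBL,
        RPL.IsExtension RPL.rationalProductLogic.{u} S' →
        RPL.IsAlgebraizedBy S' (RPL.quasivarietyGen.{u} (L := RPL.RBL) RPL.RatUnit) →
        S' = S)) ∧
    -- a base for the admissible rules; `Q` may be all of `(0, 1) ∩ ℚ` or a single point of it
    (∀ Q : Set RPL.RatUnit, Q.Nonempty → Q ⊆ Set.Ioo 0 1 →
      RPL.IsBaseForAdmissibleRules RPL.rationalProductLogic.{u} (RPL.baseRules Q)) ∧
    -- axiomatization of the universal theory of `Q_Π` relative to rational product algebras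
    (∀ Q : Set RPL.RatUnit, Q.Nonempty → Q ⊆ Set.Ioo 0 1 →
      ∀ (A : Type u) [RPL.RBL.Structure A], RPL.IsRationalProductAlgebra.{u} A →
        (RPL.SatisfiesUniversalTheory.{u} RPL.RatUnit A ↔
          RPL.SatisfiesChainAxioms.{u} Q A)) := by
  refine ⟨⟨RPL.ratLogic, RPL.isStructuralCompletion_ratLogic,
    fun S' h => h.unique RPL.isStructuralCompletion_ratLogic, RPL.isExtension_ratLogic,
    RPL.isAlgebraizedBy_ratLogic, fun S' h h' => RPL.eq_ratLogic_of_isAlgebraizedBy h h'⟩,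
    fun Q hQ hQ' => RPL.isBaseForAdmissibleRules_baseRules hQ hQ',
    fun Q hQ hQ' A _ hA => ⟨RPL.satisfiesChainAxioms_of_universalTheory hQ', fun h φ hφ hB => ?_⟩⟩
  by_contra hcon
  obtain ⟨b, y, hy⟩ := RPL.exists_not_realize_of_isUniversal hA
    (RPL.satisfiesChainAxioms_iff.1 h).1 (h.isFaithful hA hQ hQ') hφ _ _ hcon
  rw [Subsingleton.elim b default, Subsingleton.elim y default] at hy
  exact hy hB
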